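/- Let $m,\ell\ge 1$ be integers. Let $D([0,1]^m)$ be the Banach space, with norm $\|f\|=\sup_{t\in[0,1]^m}|f(t)|$, of all functions $f:[0,1]^m\to\mathbb R$ such that, for every $t\in[0,1]^m$, the limit of $f(s)$ as $s\to t$ exists in $\mathbb R$ within each of the octants $J_1\times\dots\times J_m$, where each $J_i$ is either $[t_i,1]$ or $[0,t_i)$ (the latter only if $t_i>0$). Let $\mathcal D$ be the $\sigma$-field on $D([0,1]^m)$ generated by the point evaluations $f\mapsto f(t)$, $t\in[0,1]^m$. For a real Banach space $B$, let $B^{\hat\otimes\ell}$ and $B^{\check\otimes\ell}$ be the projective and injective tensor powers, that is, the completions of the algebraic tensor power $B^{\otimes\ell}$ in the norms $$\|u\|_\pi=\inf\Big\{\sum_j\prod_{i=1}^\ell\|x_{ji}\| : u=\sum_j x_{j1}\otimes\dots\otimes x_{j\ell}\Big\}\ \text{(finite sums)},\qquad \|u\|_\varepsilon=\sup\big\{|(\chi_1\otimes\dots\otimes\chi_\ell)(u)| : \chi_i\in B^*,\ \|\chi_i\|\le1\big\}.$$ A function $Y$ from a probability space $(\Omega,\mathcal F,P)$ to a Banach space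 $B$ is Pettis integrable (that is, $\mathbb E\,Y$ exists in Pettis sense) if $\langle\chi,Y\rangle$ is measurable and integrable for every $\chi\in B^*$ and, for every $E\in\mathcal F$ (including $E=\Omega$), there is $b_E\in B$ with $\int_E\langle\chi,Y\rangle\,dP=\langle\chi,b_E\rangle$ for all $\chi\in B^*$. Theorem. Let $X:\Omega\to D([0,1]^m)$ be a $\mathcal D$-measurable random variable, defined on a probability space $(\Omega,\mathcal F,P)$, with $\mathbb E\|X\|^\ell<\infty$. Then the projective moment $\mathbb E X^{\hat\otimes\ell}$ and the injective moment $\mathbb E X^{\check\otimes\ell}$ exist in Pettis sense; that is, $X\otimes\dots\otimes X$ ($\ell$ factors) is Pettis integrable both as a function into $D([0,1]^m)^{\hat\otimes\ell}$ and as a function into $D([0,1]^m)^{\check\otimes\ell}$. -/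

import Mathlib

open MeasureTheory Filter Topology
open scoped TensorProduct unitInterval

/-! ### The space `D([0,1]^m)` -/

/-- The octant at `t ∈ [0,1]^m` of the points `s` with `s i < t i` for `i ∈ S`
and `t i ≤ s i` for `i ∉ S`. It is empty as soon as `t i = 0` for some `i ∈ S`. -/
def octant {m : ℕ} (t : Fin m → I) (S : Set (Fin m)) : Set (Fin m → I) :=
  {s | ∀ i, (i ∈ S → s i < t i) ∧ (i ∉ S → t i ≤ s i)}

/-- `f ∈ D([0,1]^m)`: at every `t`, the function `f` has a finite limit as `s → t` in every octant
at `t`. Empty octants (those that would need `s i < 0`) impose no condition, since the filter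
`𝓝[∅] t` is trivial; the octant with `S = ∅` contains `t`, so that the limit there is `f t`. -/
def IsCadlag {m : ℕ} (f : (Fin m → I) → ℝ) : Prop :=
  ∀ (t : Fin m → I) (S : Set (Fin m)), ∃ L : ℝ, Tendsto f (𝓝[octant t S] t) (𝓝 L)

theorem IsCadlag.bounded {m : ℕ} {f : (Fin m → I) → ℝ} (hf : IsCadlag f) :
    ∃ C : ℝ, ∀ t, |f t| ≤ C := by
  have key : ∀ t : Fin m → I, ∃ C : ℝ, ∀ᶠ s in 𝓝 t, |f s| ≤ C := by
    intro t
    choose L hL using hf t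
    have h1 : ∀ S : Set (Fin m), ∀ᶠ s in 𝓝 t, s ∈ octant t S → |f s| ≤ |L S| + 1 := by
      intro S
      have h2 : ∀ᶠ y in 𝓝 (L S), |y| < |L S| + 1 :=
        (continuous_abs.tendsto (L S)).eventually (gt_mem_nhds (lt_add_one _))
      have h3 := eventually_nhdsWithin_iff.1 ((hL S).eventually h2)
      exact h3.mono fun s hs hm => (hs hm).le
    refine ⟨∑ S : Set (Fin m), (|L S| + 1), ?_⟩
    filter_upwards [eventually_all.2 h1] with s hs
    have hm : s ∈ octant t {i | s i < t i} := fun i => ⟨fun h => h, fun h => not_lt.1 h⟩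
    refine (hs _ hm).trans ?_
    exact Finset.single_le_sum (f := fun S : Set (Fin m) => |L S| + 1)
      (fun S _ => by positivity) (Finset.mem_univ _)
  choose C hC using key
  obtain ⟨T, hT⟩ := CompactSpace.elim_nhds_subcover (fun t => {s | |f s| ≤ C t}) hC
  refine ⟨∑ t ∈ T, |C t|, fun s => ?_⟩
  have hs : s ∈ ⋃ t ∈ T, {s | |f s| ≤ C t} := by rw [hT]; trivial
  simp only [Set.mem_iUnion, Set.mem_ofPred_eq] at hs
  obtain ⟨t, htT, ht⟩ := hs
  exact ht.trans ((le_abs_self _).trans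
    (Finset.single_le_sum (f := fun t => |C t|) (fun t _ => abs_nonneg _) htT))

/-- `D([0,1]^m)` as a linear subspace of the space of all real functions on `[0,1]^m`. -/
def cadlagSubmodule (m : ℕ) : Submodule ℝ ((Fin m → I) → ℝ) where
  carrier := {f | IsCadlag f}
  add_mem' {f g} hf hg t S := by
    obtain ⟨a, ha⟩ := hf t S
    obtain ⟨b, hb⟩ := hg t S
    exact ⟨a + b, ha.add hb⟩
  zero_mem' _ _ := ⟨0, tendsto_const_nhds⟩
  smul_mem' c f hf t S := by
    obtain ⟨a, ha⟩ := hf t S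
    exact ⟨c • a, ha.const_smul c⟩

/-- The space `D([0,1]^m)`, as a type of its own: its topology is the one of the supremum norm
below, and not the one of pointwise convergence. -/
def CadlagSpace (m : ℕ) : Type := cadlagSubmodule m

namespace CadlagSpace

variable {m : ℕ}

instance : AddCommGroup (CadlagSpace m) := inferInstanceAs (AddCommGroup (cadlagSubmodule m))

instance : Module ℝ (CadlagSpace m) := inferInstanceAs (Module ℝ (cadlagSubmodule m))

instance : FunLike (CadlagSpace m) (Fin m → I) ℝ where
  coe f := (show cadlagSubmodule m from f).1
  coe_injective := Subtype.val_injective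

theorem isCadlag (f : CadlagSpace m) : IsCadlag f := (show cadlagSubmodule m from f).2

/-- The supremum norm `‖f‖ = sup_t |f t|`. -/
noncomputable instance : Norm (CadlagSpace m) := ⟨fun f => ⨆ t : Fin m → I, |f t|⟩

theorem bddAbove_abs (f : CadlagSpace m) : BddAbove (Set.range fun t : Fin m → I => |f t|) := by
  obtain ⟨C, hC⟩ := IsCadlag.bounded f.isCadlag
  exact ⟨C, by rintro _ ⟨t, rfl⟩; exact hC t⟩

theorem abs_apply_le_norm (f : CadlagSpace m) (t : Fin m → I) : |f t| ≤ ‖f‖ :=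
  le_ciSup (bddAbove_abs f) t

theorem normedSpaceCore : NormedSpace.Core ℝ (CadlagSpace m) where
  norm_nonneg f := Real.iSup_nonneg fun _ => abs_nonneg _
  norm_smul c f := by
    change (⨆ t : Fin m → I, |c * f t|) = |c| * ⨆ t : Fin m → I, |f t|
    rw [Real.mul_iSup_of_nonneg (abs_nonneg c)]
    simp only [abs_mul]
  norm_triangle f g :=
    ciSup_le fun t => (abs_add_le (f t) (g t)).trans
      (add_le_add (abs_apply_le_norm f t) (abs_apply_le_norm g t))
  norm_eq_zero_iff f := by
    constructor
    · intro h
      refine DFunLike.ext _ _ fun t => ?_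
      exact abs_nonpos_iff.1 ((abs_apply_le_norm f t).trans h.le)
    · rintro rfl
      change (⨆ t : Fin m → I, |(0 : ℝ)|) = 0
      simp

noncomputable instance : NormedAddCommGroup (CadlagSpace m) :=
  NormedAddCommGroup.ofCore normedSpaceCore

noncomputable instance : NormedSpace ℝ (CadlagSpace m) :=
  NormedSpace.ofCore normedSpaceCore

/-- The σ-field `𝒟` on `D([0,1]^m)` that is generated by the point evaluations `f ↦ f t`.
(It is not the Borel σ-field of the norm.) -/
instance : MeasurableSpace (CadlagSpace m) :=
  ⨆ t : Fin m → I, MeasurableSpace.comap (fun f : CadlagSpace m => f t) inferInstance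

end CadlagSpace

/-! ### Projective and injective tensor powers of a normed space -/

section TensorPower

variable (ℓ : ℕ) (B : Type*) [NormedAddCommGroup B] [NormedSpace ℝ B]

/-- The projective tensor power of `B`: the completion of the algebraic tensor power for the
projective norm `‖u‖ = inf {∑ j, ∏ i, ‖x j i‖ : u = ∑ j, ⨂ i, x j i}`, which is the
norm that Mathlib puts on `⨂[ℝ] _ : Fin ℓ, B`. -/
abbrev ProjectiveTensorPower : Type _ := UniformSpace.Completion (⨂[ℝ] _ : Fin ℓ, B)

variable {ℓ B} in
/-- The linear functional `χ 1 ⊗ ⋯ ⊗ χ ℓ` on the algebraic tensor power, for `χ i ∈ B*`: it sends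
`x 1 ⊗ ⋯ ⊗ x ℓ` to `∏ i, χ i (x i)`. -/
noncomputable def tensorFunctional (χ : Fin ℓ → StrongDual ℝ B) : (⨂[ℝ] _ : Fin ℓ, B) →ₗ[ℝ] ℝ :=
  PiTensorProduct.lift
    ((ContinuousMultilinearMap.mkPiAlgebra ℝ (Fin ℓ) ℝ).compContinuousLinearMap χ).toMultilinearMap

/-- The algebraic tensor power of `B`, as a type of its own that carries the injective norm. -/
def InjectiveAlgTensor : Type _ := ⨂[ℝ] _ : Fin ℓ, B

namespace InjectiveAlgTensor

noncomputable instance : AddCommGroup (InjectiveAlgTensor ℓ B) :=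
  inferInstanceAs (AddCommGroup (⨂[ℝ] _ : Fin ℓ, B))

noncomputable instance : Module ℝ (InjectiveAlgTensor ℓ B) :=
  inferInstanceAs (Module ℝ (⨂[ℝ] _ : Fin ℓ, B))

/-- The identity map from the algebraic tensor power. -/
noncomputable def of : (⨂[ℝ] _ : Fin ℓ, B) ≃ₗ[ℝ] InjectiveAlgTensor ℓ B := LinearEquiv.refl ℝ _

/-- The injective norm `‖u‖ = sup {|(χ 1 ⊗ ⋯ ⊗ χ ℓ) u| : χ i ∈ B*, ‖χ i‖ ≤ 1}`. -/
noncomputable instance : Norm (InjectiveAlgTensor ℓ B) :=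
  ⟨fun u => ⨆ χ : {χ : Fin ℓ → StrongDual ℝ B // ∀ i, ‖χ i‖ ≤ 1},
    |tensorFunctional χ.1 ((of ℓ B).symm u)|⟩

variable {ℓ B}

theorem bddAbove_abs (u : InjectiveAlgTensor ℓ B) :
    BddAbove (Set.range fun χ : {χ : Fin ℓ → StrongDual ℝ B // ∀ i, ‖χ i‖ ≤ 1} =>
      |tensorFunctional χ.1 ((of ℓ B).symm u)|) := by
  refine ⟨‖(of ℓ B).symm u‖, ?_⟩
  rintro _ ⟨⟨χ, hχ⟩, rfl⟩
  set φ := (ContinuousMultilinearMap.mkPiAlgebra ℝ (Fin ℓ) ℝ).compContinuousLinearMap χ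
  have h1 : ‖φ‖ ≤ 1 := by
    refine ContinuousMultilinearMap.opNorm_le_bound zero_le_one fun x => ?_
    have h2 : φ x = ∏ i, χ i (x i) := by simp [φ]
    rw [h2, norm_prod, one_mul]
    exact Finset.prod_le_prod (fun i _ => norm_nonneg _)
      fun i _ => by simpa using (χ i).le_of_opNorm_le (hχ i) (x i)
  have h3 := PiTensorProduct.norm_eval_le_projectiveSeminorm φ ((of ℓ B).symm u)
  exact h3.trans (mul_le_of_le_one_left (norm_nonneg _) h1)

theorem seminormedSpaceCore : SeminormedSpace.Core ℝ (InjectiveAlgTensor ℓ B) where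
  norm_nonneg u := Real.iSup_nonneg fun _ => abs_nonneg _
  norm_smul c u := by
    change (⨆ χ : {χ : Fin ℓ → StrongDual ℝ B // ∀ i, ‖χ i‖ ≤ 1}, _) = |c| * ⨆ _, _
    rw [Real.mul_iSup_of_nonneg (abs_nonneg c)]
    simp only [map_smul, smul_eq_mul, abs_mul]
  norm_triangle u v := by
    have : Nonempty {χ : Fin ℓ → StrongDual ℝ B // ∀ i, ‖χ i‖ ≤ 1} := ⟨⟨0, by simp⟩⟩
    refine ciSup_le fun χ => ?_
    rw [map_add, map_add]
    exact (abs_add_le _ _).trans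
      (add_le_add (le_ciSup (bddAbove_abs u) χ) (le_ciSup (bddAbove_abs v) χ))

noncomputable instance : SeminormedAddCommGroup (InjectiveAlgTensor ℓ B) :=
  SeminormedAddCommGroup.ofCore seminormedSpaceCore

noncomputable instance : NormedSpace ℝ (InjectiveAlgTensor ℓ B) :=
  ⟨fun c u => (seminormedSpaceCore.norm_smul c u).le⟩

end InjectiveAlgTensor

/-- The injective tensor power of `B`: the completion of the algebraic tensor power for the
injective norm. -/
abbrev InjectiveTensorPower : Type _ := UniformSpace.Completion (InjectiveAlgTensor ℓ B)

variable {B}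

/-- `x ⊗ ⋯ ⊗ x` (`ℓ` factors) as an element of the projective tensor power. -/
noncomputable def projectivePow (x : B) : ProjectiveTensorPower ℓ B :=
  ((⨂ₜ[ℝ] _ : Fin ℓ, x : ⨂[ℝ] _ : Fin ℓ, B) : UniformSpace.Completion (⨂[ℝ] _ : Fin ℓ, B))

/-- `x ⊗ ⋯ ⊗ x` (`ℓ` factors) as an element of the injective tensor power. -/
noncomputable def injectivePow (x : B) : InjectiveTensorPower ℓ B :=
  (InjectiveAlgTensor.of ℓ B (⨂ₜ[ℝ] _ : Fin ℓ, x) :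
    UniformSpace.Completion (InjectiveAlgTensor ℓ B))

end TensorPower

/-! ### Dunford and Pettis integrals -/

section Pettis

variable {S B : Type*} [MeasurableSpace S] [NormedAddCommGroup B] [NormedSpace ℝ B]

/-- `f` is Dunford integrable: `⟨χ, f⟩` is measurable and integrable for every `χ ∈ B*`. -/
def DunfordIntegrable (f : S → B) (μ : Measure S) : Prop :=
  ∀ χ : StrongDual ℝ B, Measurable (fun s => χ (f s)) ∧ Integrable (fun s => χ (f s)) μ

/-- The element `b` of `B` (seen in the bidual) is the Dunford integral of `f` over `E`. -/
def IsDunfordIntegralOn (f : S → B) (μ : Measure S) (E : Set S) (b : B) : Prop :=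
  ∀ χ : StrongDual ℝ B, ∫ s in E, χ (f s) ∂μ = χ b

/-- `f` is Pettis integrable: it is Dunford integrable and its integral over every measurable set,
in particular over the whole space, belongs to `B`. -/
def PettisIntegrable (f : S → B) (μ : Measure S) : Prop :=
  DunfordIntegrable f μ ∧ ∀ E : Set S, MeasurableSet E → ∃ b : B, IsDunfordIntegralOn f μ E b

end Pettis

/-!
The injective moment is the image of the projective one under the contraction between the two tensor
powers, so only the projective power `B` of `D = D([0,1]^m)` matters. Its dual consists of the
bounded `ℓ`-linear forms `α` on `D`, and two things are to be shown: `α (X, …, X)` is measurable,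
and its integrals are represented by elements of `B`.

*Discontinuities of multilinear forms.* The indicators `orthant a` of `{t | a ≤ t}` span a dense
subspace of `D`, so `α` is determined by its values on them, which form a function of `ℓ * m` real
variables, the coordinates of the vertices. By `exists_countable_tendsto_orthant` this function is
right continuous in each variable outside a countable set that does not depend on the other
variables. This rests on orthogonality: signed sums of disjoint interval indicators have norm at
most `1`, so that a suitable choice of signs bounds the sum of the squares of all the mixed jumps by
`‖α‖ ^ 2`. An induction on the number of variables (`countable_setOf_ne_zero_of_sum_sq_le`) splits
each step function into a limit of steps at points of a fixed countable set and a jump.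

*Measurability.* Rounding one coordinate of one argument down to finite sets `Q n` that exhaust a
countable dense set containing the discontinuities of `α` does not change `α (f, …, f)` in the
limit. After all coordinates are rounded, only finitely many values of `f` occur, so `α (X, …, X)`
is an iterated limit of measurable functions (`measurable_multilinear_diag`).

*Pettis integrability.* A dominated Dunford integrable function into a Banach space `B` is Pettis
integrable if there is a sequence in `B` such that each functional that vanishes on it annihilates
the function almost surely (`pettisIntegrable_of_countable_separation`). Here the sequence consists
of the tensors of orthant indicators with vertices in a countable dense set `A₀` that contains the
fixed jumps of `X`. If `α` vanishes on them, then it vanishes on all orthant indicators whose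
vertices avoid the set `Z` of discontinuities of `α` outside `A₀`. Almost surely `X` has no jump at
the countable set `Z`, so it is a uniform limit of combinations of such indicators, and `α (X, …, X)
= 0` (`ae_multilinear_diag_eq_zero`).
-/

/-! ### A criterion for Pettis integrability -/

/-- Near-minimal-norm points of a decreasing sequence of bounded convex sets in an inner product
space form a Cauchy sequence, by the parallelogram law. -/
theorem exists_cauchySeq_mem_of_antitone_convex {H : Type*} [NormedAddCommGroup H]
    [InnerProductSpace ℝ H] {K : ℕ → Set H} (hK : Antitone K) (hconv : ∀ n, Convex ℝ (K n))
    (hne : ∀ n, (K n).Nonempty) {C : ℝ} (hC : ∀ x ∈ K 0, ‖x‖ ≤ C) :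
    ∃ x : ℕ → H, (∀ n, x n ∈ K n) ∧ CauchySeq x := by
  set d : ℕ → ℝ := fun n => sInf ((fun x : H => ‖x‖ ^ 2) '' K n) with hd
  have hbdd : ∀ n, BddBelow ((fun x : H => ‖x‖ ^ 2) '' K n) := fun n =>
    ⟨0, by rintro _ ⟨x, -, rfl⟩; positivity⟩
  have hdle : ∀ n, ∀ x ∈ K n, d n ≤ ‖x‖ ^ 2 := fun n x hx => csInf_le (hbdd n) ⟨x, hx, rfl⟩
  have hdmono : Monotone d := fun n k hnk =>
    csInf_le_csInf (hbdd n) ((hne k).image _) (Set.image_mono (hK hnk))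
  have hdC : ∀ n, d n ≤ C ^ 2 := fun n => by
    obtain ⟨x, hx⟩ := hne n
    have h1 := hC x (hK (Nat.zero_le n) hx)
    exact (hdle n x hx).trans (by gcongr)
  have hx : ∀ n : ℕ, ∃ x ∈ K n, ‖x‖ ^ 2 < d n + 1 / ((n : ℝ) + 1) := fun n => by
    obtain ⟨_, ⟨x, hx, rfl⟩, h⟩ := Real.lt_sInf_add_pos ((hne n).image fun x : H => ‖x‖ ^ 2)
      (ε := 1 / ((n : ℝ) + 1)) (by positivity)
    exact ⟨x, hx, h⟩
  choose x hxK hxd using hx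
  refine ⟨x, hxK, ?_⟩
  have hbdA : BddAbove (Set.range d) := ⟨C ^ 2, by rintro _ ⟨n, rfl⟩; exact hdC n⟩
  have hlim : Tendsto d atTop (𝓝 (⨆ n, d n)) := tendsto_atTop_ciSup hdmono hbdA
  set D := ⨆ n, d n
  refine cauchySeq_of_le_tendsto_0' (fun n => √(2 * (D - d n) + 4 * (1 / ((n : ℝ) + 1)))) ?_ ?_
  · intro n k hnk
    rw [dist_eq_norm]
    refine Real.le_sqrt_of_sq_le ?_
    have hmid : (1 / 2 : ℝ) • x n + (1 / 2 : ℝ) • x k ∈ K n :=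
      hconv n (hxK n) (hK hnk (hxK k)) (by norm_num) (by norm_num) (by norm_num)
    have h1 := hdle n _ hmid
    rw [← smul_add, norm_smul, mul_pow] at h1
    have h2 := parallelogram_law_with_norm ℝ (x n) (x k)
    have h3 := hxd n
    have h4 := hxd k
    have h5 : d k ≤ D := le_ciSup hbdA k
    have h6 : 1 / ((k : ℝ) + 1) ≤ 1 / ((n : ℝ) + 1) := by gcongr
    norm_num at h1
    linarith
  · have h1 : Tendsto (fun n : ℕ => 2 * (D - d n) + 4 * (1 / ((n : ℝ) + 1))) atTop
        (𝓝 (2 * (D - D) + 4 * 0)) :=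
      ((tendsto_const_nhds.sub hlim).const_mul 2).add
        (tendsto_one_div_add_atTop_nhds_zero_nat.const_mul 4)
    have h2 := (Real.continuous_sqrt.tendsto _).comp h1
    simpa [Function.comp_def] using h2

/-- A form of Helly's theorem: if a functional `φ` on the dual of `B` is not within `ε` of any point
of `B` on the dual unit ball, then some `χ` in this ball has `φ χ ≥ ε / 2` while it is arbitrarily
small at finitely many prescribed points of `B`. -/
theorem exists_dual_ball_of_not_approx {B : Type*} [NormedAddCommGroup B] [NormedSpace ℝ B]
    (φ : StrongDual ℝ B →ₗ[ℝ] ℝ) {ε : ℝ} (hε : 0 < ε)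
    (hφ : ∀ z : B, ∃ χ : StrongDual ℝ B, ‖χ‖ ≤ 1 ∧ ε < φ χ - χ z)
    {n : ℕ} (y : Fin n → B) {δ : ℝ} (hδ : 0 < δ) :
    ∃ χ : StrongDual ℝ B, ‖χ‖ ≤ 1 ∧ ε / 2 ≤ φ χ ∧ ∀ i, |χ (y i)| ≤ δ := by
  by_contra! hcon
  set Φ : StrongDual ℝ B →ₗ[ℝ] ℝ × (Fin n → ℝ) :=
    φ.prod (LinearMap.pi fun i =>
      { toFun := fun χ => χ (y i), map_add' := fun _ _ => rfl, map_smul' := fun _ _ => rfl })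
  set K : Set (ℝ × (Fin n → ℝ)) := closure (Φ '' {χ | ‖χ‖ ≤ 1}) with hKdef
  have hball : Convex ℝ {χ : StrongDual ℝ B | ‖χ‖ ≤ 1} := by
    simpa [Metric.closedBall, dist_zero_right] using
      convex_closedBall (0 : StrongDual ℝ B) (1 : ℝ)
  have hK : Convex ℝ K := (hball.linear_image Φ).closure
  have hnot : ((ε, 0) : ℝ × (Fin n → ℝ)) ∉ K := by
    intro hmem
    obtain ⟨_, ⟨χ, hχ, rfl⟩, hd⟩ := Metric.mem_closure_iff.1 hmem (min (ε / 2) δ) (by positivity)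
    rw [Prod.dist_eq, max_lt_iff, lt_min_iff, lt_min_iff] at hd
    have h1 : ε / 2 ≤ φ χ := by
      have := hd.1.1
      rw [Real.dist_eq] at this
      have h2 := (abs_lt.1 this).2
      change ε - φ χ < ε / 2 at h2
      linarith
    obtain ⟨i, hi⟩ := hcon χ hχ h1
    have h3 := (dist_le_pi_dist (0 : Fin n → ℝ) (Φ χ).2 i).trans_lt hd.2.2
    rw [Pi.zero_apply, Real.dist_eq, zero_sub, abs_neg] at h3
    exact lt_asymm hi h3
  obtain ⟨f, u, hfu, hu⟩ := geometric_hahn_banach_closed_point hK isClosed_closure hnot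
  have hdec : ∀ (s : ℝ) (v : Fin n → ℝ),
      f (s, v) = s * f (1, 0) + ∑ i, v i * f (0, Pi.single i 1) := by
    intro s v
    have h1 : ((s, v) : ℝ × (Fin n → ℝ))
        = s • ((1, 0) : ℝ × (Fin n → ℝ)) + ∑ i, v i • ((0, Pi.single i 1) : ℝ × (Fin n → ℝ)) := by
      refine Prod.ext ?_ ?_
      · simp [Prod.fst_sum]
      · simp only [Prod.snd_add, Prod.smul_snd, smul_zero, zero_add, Prod.snd_sum]
        exact pi_eq_sum_univ' v
    rw [h1, map_add, map_smul, map_sum]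
    simp only [map_smul, smul_eq_mul]
  have hu0 : 0 < u := by
    have := hfu 0 (subset_closure ⟨0, by simp, by simp⟩)
    simpa using this
  set a := f (1, 0) with ha
  have hεa : u < ε * a := by
    rw [hdec] at hu
    simpa using hu
  have ha0 : 0 < a := by
    by_contra! h
    nlinarith
  -- The separating functional, normalized to coefficient `1` at `φ`, is `φ - z` for this `z`.
  obtain ⟨χ, hχ, hχε⟩ := hφ (-∑ i, (f (0, Pi.single i 1) / a) • y i)
  have h1 := hfu (Φ χ) (subset_closure ⟨χ, hχ, rfl⟩)
  have h2 : f (Φ χ) = φ χ * a + ∑ i, χ (y i) * f (0, Pi.single i 1) := hdec (φ χ) fun i => χ (y i)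
  have h3 : φ χ - χ (-∑ i, (f (0, Pi.single i 1) / a) • y i) = f (Φ χ) / a := by
    rw [h2, map_neg, map_sum, sub_neg_eq_add, add_div, mul_div_cancel_right₀ _ ha0.ne',
      Finset.sum_div]
    congr 1
    refine Finset.sum_congr rfl fun i _ => ?_
    rw [map_smul, smul_eq_mul]
    ring
  rw [h3, lt_div_iff₀ ha0] at hχε
  linarith

section PettisCriterion

variable {Ω B : Type*} [MeasurableSpace Ω] {P : Measure Ω} [NormedAddCommGroup B] [NormedSpace ℝ B]

/-- Let `f` be dominated and let a sequence `y` in `B` be such that `χ ∘ f = 0` a.e. whenever `χ`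
vanishes on `y`. Then the Dunford integral of `f` over `E` is approximated by points of `B`,
uniformly on the dual unit ball. -/
theorem exists_approx_dunfordIntegral [IsFiniteMeasure P] {f : Ω → B}
    (hf : DunfordIntegrable f P)
    {G : Ω → ℝ} (hG : Integrable G P) (hG0 : ∀ ω, 0 ≤ G ω)
    (hfG : ∀ (χ : StrongDual ℝ B) ω, |χ (f ω)| ≤ ‖χ‖ * G ω) (y : ℕ → B)
    (hy : ∀ χ : StrongDual ℝ B, (∀ i, χ (y i) = 0) → ∀ᵐ ω ∂P, χ (f ω) = 0)
    (E : Set Ω) {ε : ℝ} (hε : 0 < ε) :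
    ∃ z : B, ∀ χ : StrongDual ℝ B, ‖χ‖ ≤ 1 → ∫ ω in E, χ (f ω) ∂P - χ z ≤ ε := by
  by_contra! hcon
  set φ : StrongDual ℝ B →ₗ[ℝ] ℝ :=
    { toFun := fun χ => ∫ ω in E, χ (f ω) ∂P
      map_add' := fun χ ψ => integral_add (hf χ).2.integrableOn (hf ψ).2.integrableOn
      map_smul' := fun c χ => integral_const_mul c _ } with hφ
  -- A functional that lies in all the sets `A n` would vanish on `y`.
  set A : ℕ → Set (StrongDual ℝ B) := fun n =>
    {χ | ‖χ‖ ≤ 1 ∧ ε / 2 ≤ φ χ ∧ ∀ i < n, |χ (y i)| ≤ 1 / ((n : ℝ) + 1)} with hA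
  have hAne : ∀ n, (A n).Nonempty := fun n => by
    obtain ⟨χ, h1, h2, h3⟩ := exists_dual_ball_of_not_approx φ hε hcon
      (fun i : Fin n => y i) (δ := 1 / ((n : ℝ) + 1)) (by positivity)
    exact ⟨χ, h1, h2, fun i hi => h3 ⟨i, hi⟩⟩
  have hAanti : Antitone A := fun n k hnk χ hχ =>
    ⟨hχ.1, hχ.2.1, fun i hi => (hχ.2.2 i (hi.trans_le hnk)).trans (by gcongr)⟩
  have hAconv : ∀ n, Convex ℝ (A n) := by
    intro n χ hχ ψ hψ a b ha hb hab
    refine ⟨?_, ?_, fun i hi => ?_⟩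
    · refine (norm_add_le _ _).trans ?_
      rw [norm_smul, norm_smul, Real.norm_of_nonneg ha, Real.norm_of_nonneg hb]
      nlinarith [hχ.1, hψ.1]
    · rw [map_add, map_smul, map_smul, smul_eq_mul, smul_eq_mul]
      nlinarith [hχ.2.1, hψ.2.1]
    · change |a * χ (y i) + b * ψ (y i)| ≤ _
      refine (abs_add_le _ _).trans ?_
      rw [abs_mul, abs_mul, abs_of_nonneg ha, abs_of_nonneg hb]
      calc a * |χ (y i)| + b * |ψ (y i)| ≤ a * (1 / ((n : ℝ) + 1)) + b * (1 / ((n : ℝ) + 1)) :=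
            add_le_add (mul_le_mul_of_nonneg_left (hχ.2.2 i hi) ha)
              (mul_le_mul_of_nonneg_left (hψ.2.2 i hi) hb)
        _ = 1 / ((n : ℝ) + 1) := by rw [← add_mul, hab, one_mul]
  -- Dividing by `1 + G` makes the functions `χ ∘ f` bounded, hence square integrable.
  have hmem : ∀ χ : StrongDual ℝ B, MemLp (fun ω => χ (f ω) * (1 + G ω)⁻¹) 2 P := by
    intro χ
    have hm : AEStronglyMeasurable (fun ω => χ (f ω) * (1 + G ω)⁻¹) P :=
      ((hf χ).1.aemeasurable.mul (hG.aestronglyMeasurable.aemeasurable.const_add 1).inv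
        ).aestronglyMeasurable
    refine MemLp.of_bound hm ‖χ‖ (Eventually.of_forall fun ω => ?_)
    have h0 := hG0 ω
    rw [norm_mul, norm_inv, Real.norm_eq_abs, Real.norm_of_nonneg (by linarith : 0 ≤ 1 + G ω),
      ← div_eq_mul_inv, div_le_iff₀ (by linarith)]
    nlinarith [hfG χ ω, norm_nonneg χ]
  set T : StrongDual ℝ B →ₗ[ℝ] Lp ℝ 2 P :=
    { toFun := fun χ => (hmem χ).toLp
      map_add' := fun χ ψ => by
        rw [← MemLp.toLp_add]
        congr 1
        ext ω
        exact add_mul _ _ _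
      map_smul' := fun c χ => by
        rw [RingHom.id_apply, ← MemLp.toLp_const_smul]
        congr 1
        ext ω
        exact mul_assoc _ _ _ } with hT
  obtain ⟨C, hC⟩ : ∃ C : ℝ, ∀ x ∈ T '' A 0, ‖x‖ ≤ C := by
    refine ⟨(measureUnivNNReal P : ℝ) ^ ((2 : ENNReal).toReal⁻¹) * 1, ?_⟩
    rintro _ ⟨χ, hχ, rfl⟩
    refine Lp.norm_le_of_ae_bound zero_le_one ?_
    filter_upwards [(hmem χ).coeFn_toLp] with ω hω
    have h0 := hG0 ω
    have h1 : (T χ : Ω → ℝ) ω = χ (f ω) * (1 + G ω)⁻¹ := hω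
    rw [h1, norm_mul, norm_inv, Real.norm_eq_abs, Real.norm_of_nonneg (by linarith : 0 ≤ 1 + G ω),
      ← div_eq_mul_inv, div_le_iff₀ (by linarith)]
    nlinarith [hfG χ ω, hχ.1]
  obtain ⟨g, hgK, hgc⟩ := exists_cauchySeq_mem_of_antitone_convex (K := fun n => T '' A n)
    (fun n k hnk => Set.image_mono (hAanti hnk)) (fun n => (hAconv n).linear_image T)
    (fun n => (hAne n).image T) hC
  choose χ hχA hχg using hgK
  obtain ⟨g0, hg0⟩ := cauchySeq_tendsto_of_complete hgc
  obtain ⟨ns, hns, hae⟩ := (tendstoInMeasure_of_tendsto_Lp hg0).exists_seq_tendsto_ae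
  have hcoe : ∀ᵐ ω ∂P, ∀ n, (g n : Ω → ℝ) ω = χ n (f ω) * (1 + G ω)⁻¹ := by
    rw [ae_all_iff]
    intro n
    rw [← hχg n]
    exact (hmem (χ n)).coeFn_toLp
  -- A weak-* cluster point of the subsequence.
  obtain ⟨ψ, -, hψ⟩ := (WeakDual.isCompact_closedBall (𝕜 := ℝ) (E := B) 0 1).exists_mapClusterPt
    (f := atTop) (u := fun k => StrongDual.toWeakDual (χ (ns k))) (by
      rw [le_principal_iff, mem_map]
      exact Eventually.of_forall fun k => by simpa using (hχA (ns k)).1)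
  obtain ⟨U, hU, hUψ⟩ := mapClusterPt_iff_ultrafilter.1 hψ
  have hUev : ∀ b : B, Tendsto (fun k => χ (ns k) b) U (𝓝 (ψ b)) := fun b =>
    ((WeakDual.eval_continuous b).tendsto ψ).comp hUψ
  have hψy : ∀ i, ψ (y i) = 0 := by
    intro i
    refine tendsto_nhds_unique (hUev (y i)) (Tendsto.mono_left ?_ hU)
    have h1 : Tendsto (fun k => 1 / ((ns k : ℝ) + 1)) atTop (𝓝 0) :=
      tendsto_one_div_add_atTop_nhds_zero_nat.comp hns.tendsto_atTop
    refine squeeze_zero_norm' ?_ h1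
    filter_upwards [eventually_gt_atTop i] with k hk
    exact (hχA (ns k)).2.2 i (hk.trans_le hns.le_apply)
  have hψf := hy (WeakDual.toStrongDual ψ) hψy
  have hlim : ∀ᵐ ω ∂P, Tendsto (fun k => χ (ns k) (f ω)) atTop (𝓝 0) := by
    filter_upwards [hae, hcoe, hψf] with ω h1 h2 h3
    have h0 : 0 < 1 + G ω := by linarith [hG0 ω]
    have h4 : Tendsto (fun k => χ (ns k) (f ω)) atTop (𝓝 ((g0 : Ω → ℝ) ω * (1 + G ω))) := by
      refine (h1.mul_const (1 + G ω)).congr fun k => ?_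
      rw [h2, inv_mul_cancel_right₀ h0.ne']
    have h5 : (g0 : Ω → ℝ) ω * (1 + G ω) = 0 := by
      rw [← h3]
      exact tendsto_nhds_unique (h4.mono_left hU) (hUev (f ω))
    rwa [h5] at h4
  have hint : Tendsto (fun k => φ (χ (ns k))) atTop (𝓝 0) := by
    have h1 := tendsto_integral_of_dominated_convergence (μ := P.restrict E)
      (F := fun k ω => χ (ns k) (f ω)) (f := fun _ => (0 : ℝ)) G
      (fun k => ((hf (χ (ns k))).1).aestronglyMeasurable) hG.integrableOn
      (fun k => Eventually.of_forall fun ω => (hfG _ ω).trans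
        (mul_le_of_le_one_left (hG0 ω) (hχA (ns k)).1))
      (ae_restrict_of_ae hlim)
    rw [integral_zero] at h1
    exact h1
  have := ge_of_tendsto' hint fun k => (hχA (ns k)).2.1
  linarith

/-- A dominated Dunford integrable function `f` is Pettis integrable as soon as there is a sequence
`y` in `B` such that `χ ∘ f = 0` a.e. for every `χ` in the dual that vanishes on `y`. -/
theorem pettisIntegrable_of_countable_separation [IsFiniteMeasure P] [CompleteSpace B] {f : Ω → B}
    (hf : DunfordIntegrable f P)
    {G : Ω → ℝ} (hG : Integrable G P) (hG0 : ∀ ω, 0 ≤ G ω)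
    (hfG : ∀ (χ : StrongDual ℝ B) ω, |χ (f ω)| ≤ ‖χ‖ * G ω) (y : ℕ → B)
    (hy : ∀ χ : StrongDual ℝ B, (∀ i, χ (y i) = 0) → ∀ᵐ ω ∂P, χ (f ω) = 0) :
    PettisIntegrable f P := by
  refine ⟨hf, fun E _ => ?_⟩
  set φ : StrongDual ℝ B →ₗ[ℝ] ℝ :=
    { toFun := fun χ => ∫ ω in E, χ (f ω) ∂P
      map_add' := fun χ ψ => integral_add (hf χ).2.integrableOn (hf ψ).2.integrableOn
      map_smul' := fun c χ => integral_const_mul c _ } with hφ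
  have hex : ∀ n : ℕ, ∃ z : B, ∀ χ : StrongDual ℝ B, |φ χ - χ z| ≤ 1 / ((n : ℝ) + 1) * ‖χ‖ := by
    intro n
    have hpos : (0 : ℝ) < 1 / ((n : ℝ) + 1) := by positivity
    obtain ⟨z, hz⟩ := exists_approx_dunfordIntegral hf hG hG0 hfG y hy E hpos
    refine ⟨z, fun χ => ?_⟩
    have key : ∀ χ : StrongDual ℝ B, φ χ - χ z ≤ 1 / ((n : ℝ) + 1) * ‖χ‖ := by
      intro χ
      rcases eq_or_ne χ 0 with rfl | hχ
      · simp
      · have h0 : 0 < ‖χ‖ := norm_pos_iff.2 hχ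
        have h1 : φ (‖χ‖⁻¹ • χ) - (‖χ‖⁻¹ • χ) z ≤ 1 / ((n : ℝ) + 1) :=
          hz (‖χ‖⁻¹ • χ) (by rw [norm_smul, norm_inv, norm_norm, inv_mul_cancel₀ h0.ne'])
        rw [map_smul, smul_apply, smul_eq_mul, smul_eq_mul, ← mul_sub,
          inv_mul_le_iff₀ h0] at h1
        linarith
    rw [abs_le]
    constructor
    · have := key (-χ)
      rw [map_neg, neg_apply, norm_neg] at this
      linarith
    · exact key χ
  choose z hz using hex
  have hcauchy : CauchySeq z := by
    refine cauchySeq_of_le_tendsto_0' (fun n => 2 * (1 / ((n : ℝ) + 1))) (fun n k hnk => ?_) ?_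
    · rw [dist_eq_norm]
      refine NormedSpace.norm_le_dual_bound ℝ _ (by positivity) fun χ => ?_
      have h1 := hz n χ
      have h2 := hz k χ
      have h3 : 1 / ((k : ℝ) + 1) * ‖χ‖ ≤ 1 / ((n : ℝ) + 1) * ‖χ‖ := by gcongr
      rw [map_sub, Real.norm_eq_abs]
      rw [abs_le] at *
      constructor <;> linarith
    · simpa using (tendsto_one_div_add_atTop_nhds_zero_nat (𝕜 := ℝ)).const_mul 2
  obtain ⟨b, hb⟩ := cauchySeq_tendsto_of_complete hcauchy
  refine ⟨b, fun χ => ?_⟩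
  have h1 : Tendsto (fun n => φ χ - χ (z n)) atTop (𝓝 (φ χ - χ b)) :=
    tendsto_const_nhds.sub ((χ.continuous.tendsto b).comp hb)
  have h2 : Tendsto (fun n => φ χ - χ (z n)) atTop (𝓝 0) :=
    squeeze_zero_norm (fun n => hz n χ)
      (by simpa using (tendsto_one_div_add_atTop_nhds_zero_nat (𝕜 := ℝ)).mul_const ‖χ‖)
  exact sub_eq_zero.1 (tendsto_nhds_unique h1 h2)

theorem PettisIntegrable.clm_comp {B' : Type*} [NormedAddCommGroup B']
    [NormedSpace ℝ B'] {f : Ω → B} (hf : PettisIntegrable f P) (T : B →L[ℝ] B') :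
    PettisIntegrable (fun ω => T (f ω)) P := by
  refine ⟨fun χ => hf.1 (χ.comp T), fun E hE => ?_⟩
  obtain ⟨b, hb⟩ := hf.2 E hE
  exact ⟨T b, fun χ => hb (χ.comp T)⟩

end PettisCriterion

/-! ### Octants and rounding maps -/

/-- The points `y < x` if `b` holds, and the points `y ≥ x` otherwise: one coordinate of an
octant. -/
def halfLine (b : Prop) (x : I) : Set I := {y | (b → y < x) ∧ (¬b → x ≤ y)}

theorem nhdsWithin_octant {m : ℕ} (t : Fin m → I) (S : Set (Fin m)) :
    𝓝[octant t S] t = Filter.pi fun i => 𝓝[halfLine (i ∈ S) (t i)] t i := by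
  have h : octant t S = Set.univ.pi fun i => halfLine (i ∈ S) (t i) := by
    ext s
    simp [octant, halfLine]
  rw [h, nhdsWithin_pi_univ_eq]
  rfl

theorem eventually_le_or_eventually_lt_halfLine (b : Prop) (x a : I) :
    (∀ᶠ y in 𝓝[halfLine b x] x, a ≤ y) ∨ ∀ᶠ y in 𝓝[halfLine b x] x, y < a := by
  by_cases hb : b
  · rcases lt_or_ge a x with h | h
    · exact Or.inl (nhdsWithin_le_nhds ((lt_mem_nhds h).mono fun y hy => hy.le))
    · exact Or.inr (eventually_nhdsWithin_of_forall fun y hy => (hy.1 hb).trans_le h)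
  · rcases le_or_gt a x with h | h
    · exact Or.inl (eventually_nhdsWithin_of_forall fun y hy => h.trans (hy.2 hb))
    · exact Or.inr (nhdsWithin_le_nhds (gt_mem_nhds h))

theorem exists_mem_of_mem_nhdsWithin_halfLine {C : Set I} (hC : Dense C) (hC1 : 1 ∈ C) {b : Prop}
    {x : I} (hx : b → 0 < x) {V : Set I} (hV : V ∈ 𝓝[halfLine b x] x) : ∃ y ∈ V, y ∈ C := by
  by_cases hb : b
  · have h1 : halfLine b x = Set.Iio x := by ext y; simp [halfLine, hb]
    rw [h1] at hV
    obtain ⟨l, hl, hlV⟩ := (mem_nhdsLT_iff_exists_Ioo_subset' (hx hb)).1 hV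
    obtain ⟨y, hyC, hy⟩ := hC.exists_mem_open isOpen_Ioo (Set.nonempty_Ioo.2 hl)
    exact ⟨y, hlV hy, hyC⟩
  · have h1 : halfLine b x = Set.Ici x := by ext y; simp [halfLine, hb]
    rw [h1] at hV
    rcases eq_or_lt_of_le (unitInterval.le_one' : x ≤ 1) with rfl | hx1
    · exact ⟨1, mem_of_mem_nhdsWithin Set.self_mem_Ici hV, hC1⟩
    · obtain ⟨u, hu, huV⟩ := (mem_nhdsGE_iff_exists_Ico_subset' hx1).1 hV
      obtain ⟨y, hyC, hy⟩ := hC.exists_mem_open isOpen_Ioo (Set.nonempty_Ioo.2 hu)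
      exact ⟨y, huV ⟨hy.1.le, hy.2⟩, hyC⟩

/-- A map of `[0,1]` that sends one-sided germs (`y < x` or `y ≥ x`) into one-sided germs, so that
composing with it in the coordinates preserves `D([0,1]^m)`. -/
def IsCadlagMap (r : I → I) : Prop :=
  ∀ (b : Prop) (x : I), ∃ (b' : Prop) (u : I),
    Tendsto r (𝓝[halfLine b x] x) (𝓝[halfLine b' u] u)

theorem isCadlagMap_id : IsCadlagMap id := fun b x => ⟨b, x, tendsto_id⟩

theorem IsCadlag.comp_coord {m : ℕ} {f : (Fin m → I) → ℝ} (hf : IsCadlag f) {r : Fin m → I → I}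
    (hr : ∀ i, IsCadlagMap (r i)) : IsCadlag fun s => f fun i => r i (s i) := by
  intro t S
  choose b u hbu using fun i => hr i (i ∈ S) (t i)
  obtain ⟨L, hL⟩ := hf u {i | b i}
  refine ⟨L, hL.comp ?_⟩
  rw [nhdsWithin_octant, nhdsWithin_octant, tendsto_pi]
  exact fun i => (hbu i).comp (tendsto_eval_pi _ i)

/-- Rounding down to the finite set `Q` (to `0` below `Q`). -/
noncomputable def floorTo (Q : Finset I) (x : I) : I := (Q.filter (· ≤ x)).sup id

/-- Rounding up to the finite set `Q` (to `1` above `Q`). -/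
noncomputable def ceilTo (Q : Finset I) (x : I) : I := (Q.filter (x ≤ ·)).inf id

theorem floorTo_le (Q : Finset I) (x : I) : floorTo Q x ≤ x :=
  Finset.sup_le fun _ hq => (Finset.mem_filter.1 hq).2

theorem le_ceilTo (Q : Finset I) (x : I) : x ≤ ceilTo Q x :=
  Finset.le_inf fun _ hq => (Finset.mem_filter.1 hq).2

theorem le_floorTo {Q : Finset I} {q x : I} (hq : q ∈ Q) (h : q ≤ x) : q ≤ floorTo Q x :=
  Finset.le_sup (f := id) (Finset.mem_filter.2 ⟨hq, h⟩)

theorem ceilTo_le {Q : Finset I} {q x : I} (hq : q ∈ Q) (h : x ≤ q) : ceilTo Q x ≤ q :=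
  Finset.inf_le (f := id) (Finset.mem_filter.2 ⟨hq, h⟩)

theorem floorTo_mem {Q : Finset I} (h0 : 0 ∈ Q) (x : I) : floorTo Q x ∈ Q := by
  obtain ⟨q, hq, h⟩ := Finset.exists_mem_eq_sup (Q.filter (· ≤ x))
    ⟨0, Finset.mem_filter.2 ⟨h0, unitInterval.nonneg'⟩⟩ id
  rw [floorTo, h]
  exact (Finset.mem_filter.1 hq).1

theorem ceilTo_mem {Q : Finset I} (h1 : 1 ∈ Q) (x : I) : ceilTo Q x ∈ Q := by
  obtain ⟨q, hq, h⟩ := Finset.exists_mem_eq_inf (Q.filter (x ≤ ·))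
    ⟨1, Finset.mem_filter.2 ⟨h1, unitInterval.le_one'⟩⟩ id
  rw [ceilTo, h]
  exact (Finset.mem_filter.1 hq).1

theorem ceilTo_le_iff {Q : Finset I} (h0 : 0 ∈ Q) (h1 : 1 ∈ Q) (a x : I) :
    ceilTo Q a ≤ x ↔ a ≤ floorTo Q x :=
  ⟨fun h => (le_ceilTo Q a).trans (le_floorTo (ceilTo_mem h1 a) h),
    fun h => (ceilTo_le (floorTo_mem h0 x) h).trans (floorTo_le Q x)⟩

theorem isCadlagMap_floorTo (Q : Finset I) : IsCadlagMap (floorTo Q) := by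
  intro b x
  have h : ∀ q, ∃ c : Prop, ∀ᶠ y in 𝓝[halfLine b x] x, (q ≤ y ↔ c) := fun q => by
    rcases eventually_le_or_eventually_lt_halfLine b x q with h | h
    · exact ⟨True, h.mono fun y hy => by simp [hy]⟩
    · exact ⟨False, h.mono fun y hy => by simp [hy]⟩
  choose c hc using h
  classical
  refine ⟨False, (Q.filter c).sup id, ?_⟩
  have h2 : ∀ᶠ y in 𝓝[halfLine b x] x, floorTo Q y = (Q.filter c).sup id := by
    filter_upwards [(Q.eventually_all).2 fun q _ => hc q] with y hy
    rw [floorTo, Finset.filter_congr hy]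
  refine Tendsto.mono_right (tendsto_pure.2 h2) ?_
  exact pure_le_nhdsWithin ⟨False.elim, fun _ => le_rfl⟩

/-! ### Approximation by step functions -/

/-- The function `f` does not jump across the hyperplane `s i = x`: at each point of this
hyperplane, the limits in octants that are separated only by the hyperplane agree. Only nonempty
octants are compared. -/
def NoJump {m : ℕ} (f : (Fin m → I) → ℝ) (i : Fin m) (x : I) : Prop :=
  ∀ (t : Fin m → I) (S : Set (Fin m)) (L L' : ℝ), t i = x → i ∈ S → (∀ k ∈ S, 0 < t k) →
    Tendsto f (𝓝[octant t S] t) (𝓝 L) → Tendsto f (𝓝[octant t (S \ {i})] t) (𝓝 L') → L = L'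

/-- The absence of a jump across `s i = x` can be tested on the lines in direction `i` through the
points of a countable dense set. -/
theorem noJump_of_tendsto {m : ℕ} {f : (Fin m → I) → ℝ} {C : Set I} (hC : Dense C) (hC1 : 1 ∈ C)
    {i : Fin m} {x : I}
    (h : ∀ s : Fin m → I, (∀ k, s k ∈ C) →
      Tendsto (fun y => f (Function.update s i y)) (𝓝[<] x) (𝓝 (f (Function.update s i x)))) :
    NoJump f i x := by
  rintro t S L L' rfl hiS hpos hL hL'
  rw [nhdsWithin_octant] at hL hL'
  have key : ∀ ε > 0, |L - L'| ≤ ε + ε := by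
    intro ε hε
    have h1 := hL.eventually (Metric.closedBall_mem_nhds L hε)
    have h2 := hL'.eventually (Metric.closedBall_mem_nhds L' hε)
    obtain ⟨J, -, V, hV, hVs⟩ := Filter.mem_pi.1 h1
    obtain ⟨J', -, V', hV', hVs'⟩ := Filter.mem_pi.1 h2
    have h3 : ∀ k, ∃ y ∈ C, k ≠ i → y ∈ V k ∧ y ∈ V' k := by
      intro k
      by_cases hk : k = i
      · exact ⟨1, hC1, fun h => absurd hk h⟩
      · have hV'' : V k ∩ V' k ∈ 𝓝[halfLine (k ∈ S) (t k)] t k := by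
          refine inter_mem (hV k) ?_
          have := hV' k
          simpa [hk] using this
        obtain ⟨y, hy, hyC⟩ := exists_mem_of_mem_nhdsWithin_halfLine hC hC1 (hpos k) hV''
        exact ⟨y, hyC, fun _ => hy⟩
    choose s hsC hs using h3
    have h4 : |f (Function.update s i (t i)) - L'| ≤ ε := by
      refine hVs' (a := Function.update s i (t i)) fun k _ => ?_
      by_cases hk : k = i
      · subst hk
        rw [Function.update_self]
        exact mem_of_mem_nhdsWithin (by simp [halfLine]) (hV' k)
      · rw [Function.update_of_ne hk]
        exact (hs k hk).2
    have h5 : ∀ᶠ y in 𝓝[<] t i, |f (Function.update s i y) - L| ≤ ε := by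
      have hVi := hV i
      have : halfLine (i ∈ S) (t i) = Set.Iio (t i) := by ext y; simp [halfLine, hiS]
      rw [this] at hVi
      filter_upwards [hVi] with y hy
      refine hVs (a := Function.update s i y) fun k _ => ?_
      by_cases hk : k = i
      · subst hk
        rwa [Function.update_self]
      · rw [Function.update_of_ne hk]
        exact (hs k hk).1
    have hne : (𝓝[<] t i).NeBot := nhdsLT_neBot_of_exists_lt ⟨0, hpos i hiS⟩
    have h6 : |f (Function.update s i (t i)) - L| ≤ ε :=
      le_of_tendsto ((h s hsC).sub_const L).abs h5
    rw [abs_le] at *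
    constructor <;> linarith
  refine sub_eq_zero.1 (abs_nonpos_iff.1 (le_of_forall_pos_le_add fun ε hε => ?_))
  have := key (ε / 2) (by positivity)
  linarith

/-- Rounding down to finite sets that contain suitable points outside `Z` preserves a neighbourhood
of `x`, and also the side of `x` unless `x ∈ Z`. -/
theorem exists_floorTo_mem_nhds {Z : Set I} (hZ : Dense Zᶜ) (hZ0 : 0 ∉ Z) {x : I} {V : Set I}
    (hV : V ∈ 𝓝 x) : ∃ R : Finset I, (↑R ⊆ Zᶜ) ∧ ∃ W ∈ 𝓝 x, ∀ Q : Finset I, R ⊆ Q → ∀ y ∈ W,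
      y ∈ V ∧ floorTo Q y ∈ V ∧ (x ∉ Z → (y < x ↔ floorTo Q y < x)) := by
  classical
  set V' := Set.ordConnectedComponent V x
  have hV' : V' ∈ 𝓝 x := Set.ordConnectedComponent_mem_nhds.2 hV
  have hV'V : V' ⊆ V := Set.ordConnectedComponent_subset
  have hconn : V'.OrdConnected := inferInstance
  obtain ⟨l, hlZ, hlV, hl⟩ : ∃ l ∈ Zᶜ, l ∈ V' ∧ Set.Ici l ∈ 𝓝 x := by
    rcases eq_or_lt_of_le (unitInterval.nonneg' : 0 ≤ x) with rfl | hx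
    · exact ⟨0, hZ0, mem_of_mem_nhds hV',
        Filter.mem_of_superset univ_mem fun y _ => unitInterval.nonneg'⟩
    · obtain ⟨a, ha, haV⟩ := exists_Ioc_subset_of_mem_nhds hV' ⟨0, hx⟩
      obtain ⟨l, hlZ, hl⟩ := hZ.exists_mem_open isOpen_Ioo (Set.nonempty_Ioo.2 ha)
      exact ⟨l, hlZ, haV ⟨hl.1, hl.2.le⟩, Ici_mem_nhds hl.2⟩
  refine ⟨if x ∈ Z then {l} else {l, x}, ?_, V' ∩ Set.Ici l, inter_mem hV' hl, ?_⟩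
  · split_ifs with hx
    · simpa using hlZ
    · simp only [Finset.coe_insert, Finset.coe_singleton, Set.insert_subset_iff,
        Set.singleton_subset_iff]
      exact ⟨hlZ, hx⟩
  · intro Q hQ y hy
    have hlQ : l ∈ Q := hQ (by split_ifs <;> simp)
    refine ⟨hV'V hy.1, hV'V (hconn.out hlV hy.1 ⟨le_floorTo hlQ hy.2, floorTo_le Q y⟩),
      fun hx => ⟨fun h => (floorTo_le Q y).trans_lt h, fun h => ?_⟩⟩
    by_contra! hxy
    exact absurd h (not_lt.2 (le_floorTo (hQ (by simp [hx])) hxy))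

/-- If `f` does not jump at the points of `Z`, then `f` is uniformly approximated by rounding its
arguments to finite sets that avoid `Z`. -/
theorem IsCadlag.exists_floorTo_approx {m : ℕ} {f : (Fin m → I) → ℝ} (hf : IsCadlag f) {Z : Set I}
    (hZ : Dense Zᶜ) (hZ0 : 0 ∉ Z) (hZ1 : 1 ∉ Z) (hfZ : ∀ i, ∀ x ∈ Z, NoJump f i x)
    {ε : ℝ} (hε : 0 < ε) :
    ∃ Q : Finset I, ↑Q ⊆ Zᶜ ∧ 0 ∈ Q ∧ 1 ∈ Q ∧ ∀ s, |f s - f fun i => floorTo Q (s i)| ≤ ε := by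
  classical
  have key : ∀ t : Fin m → I, ∃ R : Finset I, (↑R ⊆ Zᶜ) ∧ ∃ W ∈ 𝓝 t, ∀ Q : Finset I, R ⊆ Q →
      ∀ s ∈ W, |f s - f fun i => floorTo Q (s i)| ≤ ε := by
    intro t
    choose L hL using hf t
    have hLZ : ∀ (T : Finset (Fin m)), (∀ i ∈ T, t i ∈ Z) → ∀ S : Set (Fin m),
        (∀ k ∈ S, 0 < t k) → L S = L (S \ T) := by
      intro T
      induction T using Finset.induction_on with
      | empty => intro _ S _; simp
      | insert i T hi ih =>
        intro hT S hS
        rw [ih (fun k hk => hT k (Finset.mem_insert_of_mem hk)) S hS]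
        have hdiff : S \ ↑(insert i T) = (S \ ↑T) \ {i} := by
          ext k
          simp only [Finset.coe_insert, Set.mem_sdiff, Set.mem_insert_iff, Set.mem_singleton_iff]
          tauto
        rw [hdiff]
        by_cases hiS : i ∈ S \ (T : Set (Fin m))
        · exact hfZ i (t i) (hT i (Finset.mem_insert_self i T)) t _ _ _ rfl hiS
            (fun k hk => hS k hk.1) (hL _) (hL _)
        · rw [Set.sdiff_singleton_eq_self hiS]
    have h1 : ∀ S : Set (Fin m), ∀ᶠ s in 𝓝 t, s ∈ octant t S → |f s - L S| ≤ ε / 2 := fun S =>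
      eventually_nhdsWithin_iff.1
        ((hL S).eventually (Metric.closedBall_mem_nhds (L S) (half_pos hε)))
    have h2 := eventually_all.2 h1
    rw [nhds_pi] at h2
    obtain ⟨J, -, V, hV, hVs⟩ := Filter.mem_pi.1 h2
    choose R hRZ W hW hRW using fun i => exists_floorTo_mem_nhds hZ hZ0 (hV i)
    refine ⟨Finset.univ.biUnion R, ?_, Set.univ.pi W,
      set_pi_mem_nhds Set.finite_univ fun i _ => hW i, ?_⟩
    · intro q hq
      obtain ⟨i, -, hi⟩ := Finset.mem_biUnion.1 (Finset.mem_coe.1 hq)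
      exact hRZ i hi
    · intro Q hQ s hs
      have h3 := fun i => hRW i Q ((Finset.subset_biUnion_of_mem R (Finset.mem_univ i)).trans hQ)
        (s i) (hs i trivial)
      have hocts : ∀ s : Fin m → I, s ∈ octant t {i | s i < t i} := fun s i =>
        ⟨fun h => h, fun h => not_lt.1 h⟩
      set s' : Fin m → I := fun i => floorTo Q (s i)
      have h4 := hVs (a := s) (fun i _ => (h3 i).1) _ (hocts s)
      have h5 := hVs (a := s') (fun i _ => (h3 i).2.1) _ (hocts s')
      have h6 : L {i | s i < t i} = L {i | s' i < t i} := by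
        set T : Finset (Fin m) := Finset.univ.filter fun i => t i ∈ Z
        have hT : ∀ i ∈ T, t i ∈ Z := fun i hi => (Finset.mem_filter.1 hi).2
        rw [hLZ T hT {i | s i < t i} fun k hk => unitInterval.nonneg'.trans_lt hk,
          hLZ T hT {i | s' i < t i} fun k hk => unitInterval.nonneg'.trans_lt hk]
        congr 1
        ext i
        simp only [Set.mem_sdiff, Set.mem_ofPred_eq, Finset.mem_coe, T, Finset.mem_filter,
          Finset.mem_univ, true_and]
        exact and_congr_left fun hi => (h3 i).2.2 hi
      rw [h6] at h4
      rw [abs_le] at *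
      constructor <;> linarith
  choose R hRZ W hW hRW using key
  obtain ⟨T, hT⟩ := CompactSpace.elim_nhds_subcover W hW
  refine ⟨insert 0 (insert 1 (T.biUnion R)), ?_, by simp, by simp, fun s => ?_⟩
  · intro q hq
    simp only [Finset.coe_insert, Set.mem_insert_iff, Finset.mem_coe, Finset.mem_biUnion] at hq
    rcases hq with rfl | rfl | ⟨t, -, hq⟩
    · exact hZ0
    · exact hZ1
    · exact hRZ t hq
  · have hs : s ∈ ⋃ t ∈ T, W t := by rw [hT]; trivial
    simp only [Set.mem_iUnion] at hs
    obtain ⟨t, htT, ht⟩ := hs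
    refine hRW t _ ?_ s ht
    intro q hq
    simp only [Finset.mem_insert, Finset.mem_biUnion]
    exact Or.inr (Or.inr ⟨t, htT, hq⟩)

/-! ### Orthant indicators span a dense subspace -/

namespace CadlagSpace

variable {m : ℕ}

/-- The element of `D([0,1]^m)` given by a function. -/
def ofFun (f : (Fin m → I) → ℝ) (hf : IsCadlag f) : CadlagSpace m :=
  (⟨f, hf⟩ : cadlagSubmodule m)

@[simp] theorem sub_apply (f g : CadlagSpace m) (t : Fin m → I) : (f - g) t = f t - g t := rfl

@[simp] theorem smul_apply (c : ℝ) (f : CadlagSpace m) (t : Fin m → I) : (c • f) t = c * f t := rfl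

/-- The inclusion of `D([0,1]^m)` into the algebra of all functions. -/
def coeLM (m : ℕ) : CadlagSpace m →ₗ[ℝ] ((Fin m → I) → ℝ) := (cadlagSubmodule m).subtype

@[simp] theorem coeLM_apply (f : CadlagSpace m) (t : Fin m → I) : coeLM m f t = f t := rfl

theorem sum_apply {κ : Type*} (s : Finset κ) (f : κ → CadlagSpace m) (t : Fin m → I) :
    (∑ k ∈ s, f k) t = ∑ k ∈ s, f k t := by
  rw [← coeLM_apply, map_sum, Finset.sum_apply]
  rfl

theorem norm_le_of_forall {f : CadlagSpace m} {C : ℝ} (h : ∀ t, |f t| ≤ C) : ‖f‖ ≤ C :=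
  ciSup_le h

open Classical in
/-- The indicator function of the orthant `{t | a ≤ t}`. -/
noncomputable def orthant (a : Fin m → I) : CadlagSpace m :=
  ofFun (fun t => if a ≤ t then 1 else 0) (by
    intro t S
    rw [nhdsWithin_octant]
    by_cases h : ∀ i, ∀ᶠ y in 𝓝[halfLine (i ∈ S) (t i)] t i, a i ≤ y
    · refine ⟨1, tendsto_const_nhds.congr' ?_⟩
      have h1 : ∀ᶠ s in Filter.pi fun i => 𝓝[halfLine (i ∈ S) (t i)] t i, ∀ i, a i ≤ s i :=
        eventually_all.2 fun i => (tendsto_eval_pi _ i).eventually (h i)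
      filter_upwards [h1] with s hs
      rw [if_pos (show a ≤ s from hs)]
    · obtain ⟨i, hi⟩ := not_forall.1 h
      have h1 := (eventually_le_or_eventually_lt_halfLine (i ∈ S) (t i) (a i)).resolve_left hi
      refine ⟨0, tendsto_const_nhds.congr' ?_⟩
      filter_upwards [(tendsto_eval_pi _ i).eventually h1] with s hs
      rw [if_neg fun h => absurd (h i) (not_le.2 hs)])

open Classical in
theorem orthant_apply (a t : Fin m → I) : orthant a t = if a ≤ t then 1 else 0 := by
  rfl

/-- Composition of `f` with maps of the coordinates, as a linear operator on `D([0,1]^m)`. -/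
def compCoord (r : Fin m → I → I) (hr : ∀ i, IsCadlagMap (r i)) :
    CadlagSpace m →ₗ[ℝ] CadlagSpace m where
  toFun f := ofFun (fun s => f fun i => r i (s i)) (f.isCadlag.comp_coord hr)
  map_add' _ _ := rfl
  map_smul' _ _ := rfl

@[simp] theorem compCoord_apply (r : Fin m → I → I) (hr : ∀ i, IsCadlagMap (r i))
    (f : CadlagSpace m) (s : Fin m → I) : compCoord r hr f s = f fun i => r i (s i) := rfl

theorem norm_compCoord_le (r : Fin m → I → I) (hr : ∀ i, IsCadlagMap (r i))
    (f : CadlagSpace m) : ‖compCoord r hr f‖ ≤ ‖f‖ :=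
  norm_le_of_forall fun _ => abs_apply_le_norm f _

open Classical in
/-- The indicator function of a cell of the grid `∏ i, Q i`, that is, of the points that are rounded
to `q`, is a linear combination of orthant indicators with vertices on the grid. -/
theorem exists_cell {Q : Fin m → Finset I} (h0 : ∀ i, 0 ∈ Q i) {q : Fin m → I}
    (hq : ∀ i, q i ∈ Q i) :
    ∃ e ∈ Submodule.span ℝ (orthant '' {a : Fin m → I | ∀ i, a i ∈ Q i}),
      ∀ s, e s = if (fun i => floorTo (Q i) (s i)) = q then 1 else 0 := by
  -- The orthant indicators with vertices on the grid form a monoid under multiplication.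
  set M : Submonoid ((Fin m → I) → ℝ) :=
    { carrier := coeLM m '' (orthant '' {a : Fin m → I | ∀ i, a i ∈ Q i})
      one_mem' := by
        refine ⟨_, ⟨0, h0, rfl⟩, ?_⟩
        ext t
        have : (0 : Fin m → I) ≤ t := fun i => unitInterval.nonneg'
        simp [orthant_apply, this]
      mul_mem' := by
        rintro _ _ ⟨_, ⟨a, ha, rfl⟩, rfl⟩ ⟨_, ⟨b, hb, rfl⟩, rfl⟩
        refine ⟨_, ⟨a ⊔ b, fun i => ?_, rfl⟩, ?_⟩
        · rcases le_total (a i) (b i) with h | h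
          · simpa [Pi.sup_apply, sup_eq_right.2 h] using hb i
          · simpa [Pi.sup_apply, sup_eq_left.2 h] using ha i
        · ext t
          simp only [coeLM_apply, orthant_apply, Pi.mul_apply, sup_le_iff]
          split_ifs <;> simp_all } with hM
  have hmem : (fun s : Fin m → I => if (fun i => floorTo (Q i) (s i)) = q then (1 : ℝ) else 0)
      ∈ Algebra.adjoin ℝ (M : Set ((Fin m → I) → ℝ)) := by
    have hprod : (fun s : Fin m → I => if (fun i => floorTo (Q i) (s i)) = q then (1 : ℝ) else 0)
        = ∏ i, fun s : Fin m → I => if floorTo (Q i) (s i) = q i then (1 : ℝ) else 0 := by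
      ext s
      rw [Finset.prod_apply, Finset.prod_boole]
      simp [funext_iff]
    rw [hprod]
    refine Subalgebra.prod_mem _ fun i _ => ?_
    have hup : ∀ x ∈ Q i, (fun s : Fin m → I => if x ≤ s i then (1 : ℝ) else 0)
        ∈ Algebra.adjoin ℝ (M : Set ((Fin m → I) → ℝ)) := by
      intro x hx
      refine Algebra.subset_adjoin ⟨_, ⟨Function.update 0 i x, fun k => ?_, rfl⟩, ?_⟩
      · by_cases hk : k = i
        · subst hk; simpa using hx
        · rw [Function.update_of_ne hk]; exact h0 k
      · ext s
        have : Function.update (0 : Fin m → I) i x ≤ s ↔ x ≤ s i := by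
          refine ⟨fun h => by simpa using h i, fun h k => ?_⟩
          by_cases hk : k = i
          · subst hk; simpa using h
          · rw [Function.update_of_ne hk]; exact unitInterval.nonneg'
        simp [orthant_apply, this]
    by_cases hne : ((Q i).filter (q i < ·)).Nonempty
    · obtain ⟨p, hp, hmin⟩ := Finset.exists_min_image _ id hne
      rw [Finset.mem_filter] at hp
      have : (fun s : Fin m → I => if floorTo (Q i) (s i) = q i then (1 : ℝ) else 0)
          = (fun s => if q i ≤ s i then (1 : ℝ) else 0) -
            fun s => if p ≤ s i then (1 : ℝ) else 0 := by
        ext s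
        rw [Pi.sub_apply]
        by_cases h1 : p ≤ s i
        · have h2 : floorTo (Q i) (s i) ≠ q i := (hp.2.trans_le (le_floorTo hp.1 h1)).ne'
          simp [h1, h2, hp.2.le.trans h1]
        · by_cases h2 : q i ≤ s i
          · have h3 : floorTo (Q i) (s i) = q i := by
              refine le_antisymm ?_ (le_floorTo (hq i) h2)
              by_contra! h4
              exact h1 ((hmin _ (Finset.mem_filter.2 ⟨floorTo_mem (h0 i) _, h4⟩)).trans
                (floorTo_le (Q i) _))
            simp [h1, h2, h3]
          · have h3 : floorTo (Q i) (s i) ≠ q i := fun h => h2 (h ▸ floorTo_le (Q i) _)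
            simp [h1, h2, h3]
      rw [this]
      exact Subalgebra.sub_mem _ (hup _ (hq i)) (hup _ hp.1)
    · have : (fun s : Fin m → I => if floorTo (Q i) (s i) = q i then (1 : ℝ) else 0)
          = fun s => if q i ≤ s i then (1 : ℝ) else 0 := by
        ext s
        have : floorTo (Q i) (s i) = q i ↔ q i ≤ s i := by
          refine ⟨fun h => h ▸ floorTo_le (Q i) _, fun h => le_antisymm ?_ (le_floorTo (hq i) h)⟩
          by_contra! h4
          exact hne ⟨_, Finset.mem_filter.2 ⟨floorTo_mem (h0 i) _, h4⟩⟩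
        simp [this]
      rw [this]
      exact hup _ (hq i)
  rw [← Subalgebra.mem_toSubmodule, Algebra.adjoin_eq_span, Submonoid.closure_eq] at hmem
  change _ ∈ Submodule.span ℝ (coeLM m '' _) at hmem
  rw [Submodule.span_image] at hmem
  obtain ⟨e, he, hes⟩ := hmem
  exact ⟨e, he, fun s => congrFun hes s⟩

open Classical in
/-- Rounding the arguments of `f` to a grid gives a finite linear combination of indicators of
cells, with the values of `f` on the grid as coefficients. -/
theorem exists_compCoord_floorTo_eq_sum {Q : Fin m → Finset I} (h0 : ∀ i, 0 ∈ Q i) :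
    ∃ e : (Fin m → I) → CadlagSpace m,
      (∀ q ∈ Fintype.piFinset Q,
        e q ∈ Submodule.span ℝ (orthant '' {a : Fin m → I | ∀ i, a i ∈ Q i})) ∧
      ∀ f : CadlagSpace m, compCoord (fun i => floorTo (Q i)) (fun i => isCadlagMap_floorTo (Q i)) f
        = ∑ q ∈ Fintype.piFinset Q, f q • e q := by
  have h : ∀ q : Fin m → I, ∃ e : CadlagSpace m, (∀ i, q i ∈ Q i) →
      e ∈ Submodule.span ℝ (orthant '' {a : Fin m → I | ∀ i, a i ∈ Q i}) ∧
      ∀ s, e s = if (fun i => floorTo (Q i) (s i)) = q then 1 else 0 := by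
    intro q
    by_cases hq : ∀ i, q i ∈ Q i
    · obtain ⟨e, he⟩ := exists_cell h0 hq
      exact ⟨e, fun _ => he⟩
    · exact ⟨0, fun h => absurd h hq⟩
  choose e he using h
  refine ⟨e, fun q hq => (he q (Fintype.mem_piFinset.1 hq)).1, fun f => ?_⟩
  refine DFunLike.ext _ _ fun s => ?_
  rw [sum_apply, compCoord_apply, Finset.sum_eq_single fun i => floorTo (Q i) (s i)]
  · rw [smul_apply, (he _ fun i => floorTo_mem (h0 i) (s i)).2, if_pos rfl, mul_one]
  · intro q hq hne
    rw [smul_apply, (he q (Fintype.mem_piFinset.1 hq)).2, if_neg hne.symm, mul_zero]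
  · intro h
    exact absurd (Fintype.mem_piFinset.2 fun i => floorTo_mem (h0 i) (s i)) h

/-- A function without jumps at the points of `Z` is a uniform limit of linear combinations of
orthant indicators whose vertices have no coordinate in `Z`. -/
theorem mem_closure_span_orthant (f : CadlagSpace m) {Z : Set I}
    (hZ : Dense Zᶜ) (hZ0 : 0 ∉ Z) (hZ1 : 1 ∉ Z) (hfZ : ∀ i, ∀ x ∈ Z, NoJump f i x) :
    f ∈ closure (Submodule.span ℝ (orthant '' {a : Fin m → I | ∀ i, a i ∉ Z}) :
      Set (CadlagSpace m)) := by
  refine Metric.mem_closure_iff.2 fun ε hε => ?_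
  obtain ⟨Q, hQZ, h0, -, hQ⟩ := f.isCadlag.exists_floorTo_approx hZ hZ0 hZ1 hfZ (half_pos hε)
  obtain ⟨e, he, hsum⟩ := exists_compCoord_floorTo_eq_sum (m := m) (Q := fun _ => Q) fun _ => h0
  refine ⟨compCoord (fun _ => floorTo Q) (fun _ => isCadlagMap_floorTo Q) f, ?_, ?_⟩
  · rw [hsum, SetLike.mem_coe]
    refine Submodule.sum_mem _ fun q hq => Submodule.smul_mem _ _ ?_
    refine Submodule.span_mono (Set.image_mono fun a ha i => ?_) (he q hq)
    exact hQZ (ha i)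
  · rw [dist_eq_norm]
    exact (norm_le_of_forall fun s => hQ s).trans_lt (half_lt_self hε)

theorem compCoord_orthant {r : Fin m → I → I} (hr : ∀ i, IsCadlagMap (r i)) {c : Fin m → I → I}
    (hc : ∀ i x y, c i x ≤ y ↔ x ≤ r i y) (a : Fin m → I) :
    compCoord r hr (orthant a) = orthant fun i => c i (a i) := by
  classical
  refine DFunLike.ext _ _ fun s => ?_
  have : (a ≤ fun i => r i (s i)) ↔ (fun i => c i (a i)) ≤ s :=
    forall_congr' fun i => (hc i (a i) (s i)).symm
  simp [orthant_apply, this]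

end CadlagSpace

/-! ### Multilinear forms on `D([0,1])` have countably many discontinuities -/

namespace CadlagSpace

/-- The step function `1_{[x,1]}` in `D([0,1])`. -/
noncomputable def step (x : I) : CadlagSpace 1 := orthant fun _ => x

open Classical in
theorem step_apply (x : I) (t : Fin 1 → I) : step x t = if x ≤ t 0 then 1 else 0 := by
  have : (fun _ => x) ≤ t ↔ x ≤ t 0 := ⟨fun h => h 0, fun h i => by rwa [Subsingleton.elim i 0]⟩
  simp [step, orthant_apply, this]

theorem norm_step_zero_pos : 0 < ‖step 0‖ := by
  have h := abs_apply_le_norm (step 0) 0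
  rw [step_apply, if_pos (show (0 : I) ≤ (0 : Fin 1 → I) 0 from le_rfl), abs_one] at h
  linarith

/-- Signed sums of indicators of disjoint intervals `[a k, b k)` have norm at most `1`. -/
theorem norm_sum_smul_step_sub_le {κ : Type*} (s : Finset κ) (a b : κ → I)
    (hab : ∀ k ∈ s, a k ≤ b k)
    (hdisj : (s : Set κ).PairwiseDisjoint fun k => Set.Ico (a k) (b k))
    (ε : κ → ℝ) (hε : ∀ k, |ε k| ≤ 1) : ‖∑ k ∈ s, ε k • (step (a k) - step (b k))‖ ≤ 1 := by
  classical
  refine norm_le_of_forall fun t => ?_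
  rw [sum_apply]
  have hval : ∀ k ∈ s, (ε k • (step (a k) - step (b k))) t
      = if t 0 ∈ Set.Ico (a k) (b k) then ε k else 0 := by
    intro k hk
    rw [smul_apply, sub_apply, step_apply, step_apply]
    by_cases h1 : b k ≤ t 0
    · simp [h1, (hab k hk).trans h1]
    · by_cases h2 : a k ≤ t 0 <;> simp [h1, h2, Set.mem_Ico, not_le.1 h1]
  rw [Finset.sum_congr rfl hval]
  by_cases h : ∃ k ∈ s, t 0 ∈ Set.Ico (a k) (b k)
  · obtain ⟨k, hk, hkt⟩ := h
    rw [Finset.sum_eq_single k]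
    · rw [if_pos hkt]
      exact hε k
    · intro l hl hlk
      rw [if_neg fun hlt => Set.disjoint_left.1 (hdisj hl hk hlk) hlt hkt]
    · exact fun h => absurd hk h
  · push Not at h
    rw [Finset.sum_eq_zero fun k hk => if_neg (h k hk)]
    simp

/-- The total variation of `x ↦ φ (step x)` is at most `C`. -/
theorem boundedVariationOn_step (φ : CadlagSpace 1 →ₗ[ℝ] ℝ) {C : ℝ} (hC : ∀ v, |φ v| ≤ C * ‖v‖) :
    BoundedVariationOn (fun x => φ (step x)) Set.univ := by
  refine ne_top_of_le_ne_top (b := ENNReal.ofReal C) ENNReal.ofReal_ne_top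
    (iSup_le fun ⟨n, u, hu, _⟩ => ?_)
  have hC0 : 0 ≤ C := by
    by_contra! h
    have h1 := hC (step 0)
    nlinarith [abs_nonneg (φ (step 0)), norm_step_zero_pos]
  have h1 : ∀ i, edist (φ (step (u (i + 1)))) (φ (step (u i)))
      = ENNReal.ofReal |φ (step (u i) - step (u (i + 1)))| := fun i => by
    rw [edist_comm, edist_dist, Real.dist_eq, map_sub]
  simp only [h1]
  rw [← ENNReal.ofReal_sum_of_nonneg fun _ _ => abs_nonneg _]
  refine ENNReal.ofReal_le_ofReal ?_
  set ε : ℕ → ℝ := fun i => SignType.sign (φ (step (u i) - step (u (i + 1)))) with hεdef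
  have hε : ∀ i, |ε i| ≤ 1 := fun i => by
    simp only [hεdef]
    rcases SignType.sign (φ (step (u i) - step (u (i + 1)))) with _ | _ | _ <;> simp
  have h2 : ∑ i ∈ Finset.range n, |φ (step (u i) - step (u (i + 1)))|
      = φ (∑ i ∈ Finset.range n, ε i • (step (u i) - step (u (i + 1)))) := by
    rw [map_sum]
    refine Finset.sum_congr rfl fun i _ => ?_
    rw [map_smul, smul_eq_mul, sign_mul_self]
  rw [h2]
  have h3 := norm_sum_smul_step_sub_le (Finset.range n) u (fun i => u (i + 1))
    (fun i _ => hu i.le_succ) (fun i _ j _ hij => hu.pairwise_disjoint_on_Ico_succ hij) ε hε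
  exact (le_abs_self _).trans ((hC _).trans (mul_le_of_le_one_right hC0 h3))

/-- Signs can be chosen such that the squared Euclidean length of the signed sum of vectors is at
least the sum of their squared lengths, by the parallelogram law. -/
theorem exists_signs_sum_sq_le {κ T : Type*} (X : Finset κ) (s : Finset T) (w : κ → T → ℝ) :
    ∃ ε : κ → ℝ, (∀ k, |ε k| ≤ 1) ∧
      ∑ k ∈ X, ∑ t ∈ s, w k t ^ 2 ≤ ∑ t ∈ s, (∑ k ∈ X, ε k * w k t) ^ 2 := by
  classical
  induction X using Finset.induction_on with
  | empty => exact ⟨0, by simp, by simp⟩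
  | insert k X hk ih =>
    obtain ⟨ε, hε, hle⟩ := ih
    set v : T → ℝ := fun t => ∑ l ∈ X, ε l * w l t with hv
    have hupd : ∀ (c : ℝ) (t : T),
        ∑ l ∈ insert k X, Function.update ε k c l * w l t = c * w k t + v t := by
      intro c t
      rw [Finset.sum_insert hk, Function.update_self]
      congr 1
      refine Finset.sum_congr rfl fun l hl => ?_
      rw [Function.update_of_ne (ne_of_mem_of_not_mem hl hk)]
    have hbound : ∀ c : ℝ, |c| ≤ 1 → ∀ l, |Function.update ε k c l| ≤ 1 := by
      intro c hc l
      by_cases hl : l = k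
      · subst hl; simpa using hc
      · simpa [hl] using hε l
    have hpar : ∑ t ∈ s, (1 * w k t + v t) ^ 2 + ∑ t ∈ s, (-1 * w k t + v t) ^ 2
        = 2 * (∑ t ∈ s, w k t ^ 2 + ∑ t ∈ s, v t ^ 2) := by
      rw [← Finset.sum_add_distrib, ← Finset.sum_add_distrib, Finset.mul_sum]
      refine Finset.sum_congr rfl fun t _ => by ring
    rw [Finset.sum_insert hk]
    rcases le_total (∑ t ∈ s, (-1 * w k t + v t) ^ 2) (∑ t ∈ s, (1 * w k t + v t) ^ 2) with h | h
    · refine ⟨Function.update ε k 1, hbound 1 (by simp), ?_⟩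
      simp only [hupd]
      linarith
    · refine ⟨Function.update ε k (-1), hbound (-1) (by simp), ?_⟩
      simp only [hupd]
      linarith

/-- The jumps of a square-summable family of functionals along the step functions are
square-summable, with the same constant. -/
theorem sum_sq_jump_le {T : Type*} (φ : T → CadlagSpace 1 →ₗ[ℝ] ℝ) {C : ℝ}
    (hC : ∀ (s : Finset T) (v : CadlagSpace 1), ∑ t ∈ s, φ t v ^ 2 ≤ C * ‖v‖ ^ 2)
    {J : T × Set.Iio (1 : I) → ℝ}
    (hJ : ∀ t (x : Set.Iio (1 : I)), Tendsto (fun y => φ t (step y)) (𝓝[>] (x : I))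
      (𝓝 (φ t (step x) - J (t, x))))
    (R : Finset (T × Set.Iio (1 : I))) : ∑ p ∈ R, J p ^ 2 ≤ C := by
  classical
  set s := R.image Prod.fst
  set X := R.image Prod.snd
  have hC0 : 0 ≤ C := by
    have h1 := hC ∅ (step 0)
    simp only [Finset.sum_empty] at h1
    exact nonneg_of_mul_nonneg_left h1 (pow_pos norm_step_zero_pos 2)
  have hRsub : R ⊆ s ×ˢ X := fun p hp =>
    Finset.mem_product.2 ⟨Finset.mem_image_of_mem _ hp, Finset.mem_image_of_mem _ hp⟩
  refine (Finset.sum_le_sum_of_subset_of_nonneg hRsub fun _ _ _ => sq_nonneg _).trans ?_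
  rw [Finset.sum_product_right]
  choose y _ hy1 hy2 using fun x : Set.Iio (1 : I) => exists_seq_strictAnti_tendsto'
    (show (x : I) < 1 from x.2)
  have hy3 : ∀ x, Tendsto (y x) atTop (𝓝[>] (x : I)) := fun x =>
    tendsto_nhdsWithin_iff.2 ⟨hy2 x, Eventually.of_forall fun n => (hy1 x n).1⟩
  have hlim : Tendsto (fun n => ∑ x ∈ X, ∑ t ∈ s, (φ t (step x - step (y x n))) ^ 2) atTop
      (𝓝 (∑ x ∈ X, ∑ t ∈ s, J (t, x) ^ 2)) := by
    refine tendsto_finsetSum _ fun x _ => tendsto_finsetSum _ fun t _ => Tendsto.pow ?_ 2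
    have h1 := ((hJ t x).comp (hy3 x)).const_sub (φ t (step x))
    rw [sub_sub_cancel] at h1
    refine h1.congr fun n => ?_
    rw [map_sub]
    rfl
  refine le_of_tendsto hlim ?_
  have hsep : ∀ᶠ n in atTop, ∀ x ∈ X, ∀ x' ∈ X, x < x' → y x n ≤ x' := by
    simp only [Finset.eventually_all]
    intro x _ x' _
    by_cases h : x < x'
    · filter_upwards [(hy2 x).eventually (ge_mem_nhds h)] with n hn _ using hn
    · exact Eventually.of_forall fun n h' => absurd h' h
  filter_upwards [hsep] with n hn
  obtain ⟨ε, hε, hle⟩ := exists_signs_sum_sq_le X s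
    fun (x : Set.Iio (1 : I)) t => φ t (step x - step (y x n))
  refine hle.trans ?_
  have hv := norm_sum_smul_step_sub_le X (fun x => (x : I)) (fun x => y x n)
    (fun x _ => (hy1 x n).1.le) (by
      intro x hx x' hx' hne
      rw [Function.onFun, Set.disjoint_left]
      intro z hz hz'
      rcases lt_or_gt_of_ne hne with h | h
      · exact absurd (hz.2.trans_le (hn x hx x' hx' h)) (not_lt.2 hz'.1)
      · exact absurd (hz'.2.trans_le (hn x' hx' x hx h)) (not_lt.2 hz.1)) ε hε
  have h1 := hC s (∑ x ∈ X, ε x • (step (x : I) - step (y x n)))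
  simp only [map_sum, map_smul, smul_eq_mul] at h1
  refine h1.trans (mul_le_of_le_one_right hC0 ?_)
  exact pow_le_one₀ (norm_nonneg _) hv

/-- The pointwise limit of multilinear forms, as a multilinear form. -/
def limMultilinear {ι κ V : Type*} [AddCommGroup V] [Module ℝ V] {l : Filter κ} [l.NeBot]
    (f : κ → MultilinearMap ℝ (fun _ : ι => V) ℝ) (F : (ι → V) → ℝ)
    (h : ∀ v, Tendsto (fun k => f k v) l (𝓝 (F v))) : MultilinearMap ℝ (fun _ : ι => V) ℝ where
  toFun := F
  map_update_add' v i x y := by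
    refine tendsto_nhds_unique (h _) (((h _).add (h _)).congr fun k => ?_)
    rw [(f k).map_update_add]
  map_update_smul' v i c x := by
    refine tendsto_nhds_unique (h _) (((h _).const_smul c).congr fun k => ?_)
    rw [(f k).map_update_smul]

/-- Let `Γ t`, for `t ∈ T`, be multilinear forms on `D([0,1])`, with one variable singled out, that
are square-summable over `t`. The jumps of `Γ t (step y)` at `y = x` form a square-summable family
of multilinear forms in the remaining variables, indexed by `(t, x)`. -/
theorem exists_jump_family {T : Type} {k : ℕ}
    (Γ : T → CadlagSpace 1 →ₗ[ℝ] MultilinearMap ℝ (fun _ : Fin k => CadlagSpace 1) ℝ) {C : ℝ}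
    (hC : ∀ (s : Finset T) v b, ∑ t ∈ s, Γ t v b ^ 2 ≤ C * ‖v‖ ^ 2 * ∏ i, ‖b i‖ ^ 2) :
    ∃ J : T × Set.Iio (1 : I) → MultilinearMap ℝ (fun _ : Fin k => CadlagSpace 1) ℝ,
      (∀ t (x : Set.Iio (1 : I)) b, Tendsto (fun y => Γ t (step y) b) (𝓝[>] (x : I))
        (𝓝 (Γ t (step x) b - J (t, x) b))) ∧
      ∀ (R : Finset (T × Set.Iio (1 : I))) b, ∑ p ∈ R, J p b ^ 2 ≤ C * ∏ i, ‖b i‖ ^ 2 := by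
  set φ : T → (Fin k → CadlagSpace 1) → CadlagSpace 1 →ₗ[ℝ] ℝ := fun t b =>
    { toFun := fun v => Γ t v b
      map_add' := fun v w => by simp
      map_smul' := fun c v => by simp } with hφ
  have hφC : ∀ (s : Finset T) b v,
      ∑ t ∈ s, φ t b v ^ 2 ≤ C * (∏ i, ‖b i‖ ^ 2) * ‖v‖ ^ 2 := fun s b v =>
    (hC s v b).trans_eq (by ring)
  have hlim : ∀ t b (x : I), Tendsto (fun y => φ t b (step y)) (𝓝[>] x)
      (𝓝 (Function.rightLim (fun y => φ t b (step y)) x)) := by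
    intro t b x
    refine (boundedVariationOn_step (φ t b) (C := √(C * ∏ i, ‖b i‖ ^ 2)) fun v => ?_
      ).tendsto_rightLim x
    have h1 := hφC {t} b v
    rw [Finset.sum_singleton] at h1
    have h2 := Real.sqrt_le_sqrt h1
    rwa [Real.sqrt_sq_eq_abs, Real.sqrt_mul' _ (sq_nonneg _), Real.sqrt_sq (norm_nonneg _)] at h2
  have hne : ∀ x : Set.Iio (1 : I), (𝓝[>] (x : I)).NeBot := fun x =>
    nhdsGT_neBot_of_exists_gt ⟨1, x.2⟩
  refine ⟨fun p => Γ p.1 (step p.2) -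
    limMultilinear (fun y => Γ p.1 (step y)) _ fun b => hlim p.1 b p.2, fun t x b => ?_,
    fun R b => ?_⟩
  · rw [_root_.sub_apply]
    change Tendsto _ _ (𝓝 (Γ t (step x) b - (Γ t (step x) b - _)))
    rw [sub_sub_cancel]
    exact hlim t b x
  · refine sum_sq_jump_le (fun t => φ t b) (fun s v => hφC s b v) (fun t x => ?_) R
    change Tendsto _ _ (𝓝 (Γ t (step x) b - (Γ t (step x) b - _)))
    rw [sub_sub_cancel]
    exact hlim t b x

/-- If multilinear forms `γ t` on `D([0,1])` are square-summable over `t ∈ T`, then only countably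
many of them are nonzero on step functions. Up to a jump, a step function is the limit of step
functions with jump points in a fixed countable dense set. Either kind of first variable leaves
multilinear forms in one variable less: countably many families for the steps, and for the jumps
one family over `T × [0,1)`, which is square-summable again. -/
theorem countable_setOf_ne_zero_of_sum_sq_le (k : ℕ) :
    ∀ {T : Type} (γ : T → MultilinearMap ℝ (fun _ : Fin k => CadlagSpace 1) ℝ) {C : ℝ},
      (∀ (s : Finset T) b, ∑ t ∈ s, γ t b ^ 2 ≤ C * ∏ i, ‖b i‖ ^ 2) →
      {t | ∃ a : Fin k → I, γ t (fun i => step (a i)) ≠ 0}.Countable := by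
  induction k with
  | zero =>
    intro T γ C hC
    have h1 : Summable fun t => γ t 0 ^ 2 :=
      summable_of_sum_le (fun _ => sq_nonneg _) (c := C) fun s => by simpa using hC s 0
    refine h1.countable_support.mono ?_
    rintro t ⟨a, ha⟩
    rw [Subsingleton.elim (fun i => step (a i)) 0] at ha
    exact pow_ne_zero 2 ha
  | succ k ih =>
    intro T γ C hC
    have hcurry : ∀ (s : Finset T) v b,
        ∑ t ∈ s, (γ t).curryLeft v b ^ 2 ≤ C * ‖v‖ ^ 2 * ∏ i, ‖b i‖ ^ 2 := by
      intro s v b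
      have := hC s (Fin.cons v b)
      simpa [Fin.prod_univ_succ, mul_assoc] using this
    obtain ⟨J, hJ, hJC⟩ := exists_jump_family (fun t => (γ t).curryLeft) hcurry
    obtain ⟨D, hDc, hD⟩ := TopologicalSpace.exists_countable_dense I
    have h1 : ∀ x, {t | ∃ a : Fin k → I, (γ t).curryLeft (step x) (fun i => step (a i)) ≠ 0
        }.Countable := fun x => ih (fun t => (γ t).curryLeft (step x)) (hcurry · (step x))
    have h2 := (ih J hJC).image Prod.fst
    refine (((hDc.insert 1).biUnion fun x _ => h1 x).union h2).mono ?_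
    rintro t ⟨a, ha⟩
    by_contra hcon
    rw [Set.mem_union, not_or] at hcon
    have hzero : ∀ x ∈ insert 1 D, (γ t).curryLeft (step x) (fun i => step (a i.succ)) = 0 := by
      intro x hx
      by_contra h
      exact hcon.1 (Set.mem_biUnion hx ⟨_, h⟩)
    have hJ0 : ∀ x, J (t, x) (fun i => step (a i.succ)) = 0 := by
      intro x
      by_contra h
      exact hcon.2 ⟨(t, x), ⟨_, h⟩, rfl⟩
    have hcons : (γ t).curryLeft (step (a 0)) (fun i => step (a i.succ)) ≠ 0 := by
      rw [MultilinearMap.curryLeft_apply]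
      convert ha using 2
      ext i : 1
      refine Fin.cases rfl (fun i => rfl) i
    rcases eq_or_lt_of_le (unitInterval.le_one' : a 0 ≤ 1) with h0 | h0
    · exact hcons (h0 ▸ hzero 1 (Set.mem_insert _ _))
    · have h3 := hJ t (⟨a 0, h0⟩ : Set.Iio (1 : I)) fun i => step (a i.succ)
      rw [hJ0, sub_zero] at h3
      refine hcons ((tendsto_nhds_unique_of_frequently_eq h3 tendsto_const_nhds ?_))
      refine frequently_iff.2 fun {U} hU => ?_
      obtain ⟨u, hu, huU⟩ := (mem_nhdsGT_iff_exists_Ioo_subset' h0).1 hU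
      obtain ⟨y, hyD, hy⟩ := hD.exists_mem_open isOpen_Ioo (Set.nonempty_Ioo.2 hu)
      exact ⟨y, huU hy, hzero y (Set.mem_insert_of_mem _ hyD)⟩

/-- A bounded multilinear form on `D([0,1])`, evaluated on step functions, is separately right
continuous in the jump points, outside a countable set that does not depend on the other jump
points. -/
theorem exists_countable_tendsto_step {N : ℕ}
    (β : MultilinearMap ℝ (fun _ : Fin N => CadlagSpace 1) ℝ) {C : ℝ}
    (hC : ∀ v, |β v| ≤ C * ∏ i, ‖v i‖) :
    ∃ A : Set I, A.Countable ∧ ∀ (a : Fin N → I) (p : Fin N), a p ∉ A →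
      Tendsto (fun y => β fun i => step (Function.update a p y i)) (𝓝[>] (a p))
        (𝓝 (β fun i => step (a i))) := by
  cases N with
  | zero => exact ⟨∅, Set.countable_empty, fun a p => p.elim0⟩
  | succ k =>
    have hcurry : ∀ p : Fin (k + 1), ∀ (s : Finset Unit) v b,
        ∑ t ∈ s, β.curryMid p v b ^ 2 ≤ C ^ 2 * ‖v‖ ^ 2 * ∏ i, ‖b i‖ ^ 2 := by
      intro p s v b
      have h1 : β.curryMid p v b ^ 2 ≤ C ^ 2 * ‖v‖ ^ 2 * ∏ i, ‖b i‖ ^ 2 := by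
        have h2 := hC (p.insertNth v b)
        rw [Fin.prod_univ_succAbove _ p] at h2
        simp only [Fin.insertNth_apply_same, Fin.insertNth_apply_succAbove] at h2
        have h3 := pow_le_pow_left₀ (abs_nonneg _) h2 2
        rw [sq_abs, mul_pow, mul_pow, ← Finset.prod_pow, ← mul_assoc] at h3
        exact h3
      rw [Finset.sum_const, nsmul_eq_mul]
      have h2 : (s.card : ℝ) ≤ 1 := by
        exact_mod_cast (Finset.card_le_univ s).trans_eq Fintype.card_unit
      exact (mul_le_of_le_one_left (sq_nonneg _) h2).trans h1
    choose J hJ hJC using fun p => exists_jump_family (fun _ : Unit => β.curryMid p) (hcurry p)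
    refine ⟨⋃ p, (fun q : Unit × Set.Iio (1 : I) => (q.2 : I)) ''
      {q | ∃ a : Fin k → I, J p q (fun i => step (a i)) ≠ 0}, Set.countable_iUnion fun p =>
        (countable_setOf_ne_zero_of_sum_sq_le k (J p) (hJC p)).image _, fun a p hap => ?_⟩
    rcases eq_or_lt_of_le (unitInterval.le_one' : a p ≤ 1) with h0 | h0
    · have : 𝓝[>] (a p) = ⊥ := by
        have h1 : Set.Ioi (a p) = ∅ := by
          rw [h0]
          exact Set.eq_empty_of_forall_notMem
            fun y hy => not_lt.2 unitInterval.le_one' hy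
        rw [h1, nhdsWithin_empty]
      rw [this]
      exact tendsto_bot
    · have hJ0 : J p ((), (⟨a p, h0⟩ : Set.Iio (1 : I))) (fun i => step (p.removeNth a i)) = 0 := by
        by_contra h
        exact hap (Set.mem_iUnion.2 ⟨p, _, ⟨_, h⟩, rfl⟩)
      have h1 := hJ p () (⟨a p, h0⟩ : Set.Iio (1 : I)) fun i => step (p.removeNth a i)
      rw [hJ0, sub_zero] at h1
      have h2 : ∀ y, β.curryMid p (step y) (fun i => step (p.removeNth a i))
          = β fun i => step (Function.update a p y i) := by
        intro y
        rw [MultilinearMap.curryMid_apply_apply, ← Fin.insertNth_removeNth]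
        congr 1
        ext i : 1
        refine Fin.succAboveCases p ?_ (fun i => ?_) i <;> simp
      simp only [h2] at h1
      rwa [Function.update_eq_self] at h1

end CadlagSpace

/-! ### Multilinear forms on `D([0,1]^m)` -/

namespace CadlagSpace

variable {m : ℕ}

/-- The product function `t ↦ ∏ i, g i (t i)` of functions `g i` in `D([0,1])`. -/
noncomputable def tensorFun (m : ℕ) :
    MultilinearMap ℝ (fun _ : Fin m => CadlagSpace 1) (CadlagSpace m) :=
  let ev : (Fin m → I) → MultilinearMap ℝ (fun _ : Fin m => CadlagSpace 1) ℝ := fun t =>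
    (MultilinearMap.mkPiAlgebra ℝ (Fin m) ℝ).compLinearMap fun i =>
      LinearMap.proj (fun _ : Fin 1 => t i) ∘ₗ coeLM 1
  { toFun := fun g => ofFun (fun t => ev t g) (by
      intro t S
      have h1 : ∀ i, ∃ L : ℝ,
          Tendsto (fun y : I => g i fun _ => y) (𝓝[halfLine (i ∈ S) (t i)] t i) (𝓝 L) := by
        intro i
        obtain ⟨L, hL⟩ := (g i).isCadlag (fun _ => t i) {_k | i ∈ S}
        refine ⟨L, hL.comp ?_⟩
        rw [nhdsWithin_octant, tendsto_pi]
        exact fun _ => tendsto_id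
      choose L hL using h1
      refine ⟨∏ i, L i, ?_⟩
      rw [nhdsWithin_octant]
      refine (tendsto_finsetProd _ fun i _ => (hL i).comp (tendsto_eval_pi _ i)).congr fun s => ?_
      simp [ev, MultilinearMap.mkPiAlgebra_apply])
    map_update_add' := fun g i x y => DFunLike.ext _ _ fun t => (ev t).map_update_add g i x y
    map_update_smul' := fun g i c x => DFunLike.ext _ _ fun t => (ev t).map_update_smul g i c x }

theorem tensorFun_apply (g : Fin m → CadlagSpace 1) (t : Fin m → I) :
    tensorFun m g t = ∏ i, g i fun _ => t i := by
  change (MultilinearMap.mkPiAlgebra ℝ (Fin m) ℝ).compLinearMap _ g = _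
  rw [MultilinearMap.compLinearMap_apply, MultilinearMap.mkPiAlgebra_apply]
  rfl

theorem norm_tensorFun_le (g : Fin m → CadlagSpace 1) : ‖tensorFun m g‖ ≤ ∏ i, ‖g i‖ :=
  norm_le_of_forall fun t => by
    rw [tensorFun_apply, Finset.abs_prod]
    exact Finset.prod_le_prod (fun _ _ => abs_nonneg _) fun i _ => abs_apply_le_norm _ _

theorem tensorFun_step (a : Fin m → I) : tensorFun m (fun i => step (a i)) = orthant a := by
  classical
  refine DFunLike.ext _ _ fun t => ?_
  simp only [tensorFun_apply, step_apply, orthant_apply, Finset.prod_boole, Pi.le_def,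
    Finset.mem_univ, true_imp_iff]

/-- A bounded multilinear form on `D([0,1]^m)`, evaluated on orthant indicators, is separately right
continuous in the coordinates of the vertices, outside a countable set that does not depend on the
other coordinates. -/
theorem exists_countable_tendsto_orthant {ℓ : ℕ}
    (α : MultilinearMap ℝ (fun _ : Fin ℓ => CadlagSpace m) ℝ) {C : ℝ}
    (hC : ∀ v, |α v| ≤ C * ∏ j, ‖v j‖) :
    ∃ A : Set I, A.Countable ∧ ∀ (a : Fin ℓ → Fin m → I) (j : Fin ℓ) (i : Fin m), a j i ∉ A →
      Tendsto (fun y => α fun j' => orthant (Function.update a j (Function.update (a j) i y) j'))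
        (𝓝[>] (a j i)) (𝓝 (α fun j' => orthant (a j'))) := by
  have hC0 : ∀ v, |α v| ≤ |C| * ∏ j, ‖v j‖ := fun v => (hC v).trans
    (mul_le_mul_of_nonneg_right (le_abs_self C) (Finset.prod_nonneg fun _ _ => norm_nonneg _))
  set e := finSigmaFinEquiv (n := fun _ : Fin ℓ => m)
  set β := (α.compMultilinearMap fun _ => tensorFun m).domDomCongr e with hβ
  have hβa : ∀ v, β v = α fun j => tensorFun m fun i => v (e ⟨j, i⟩) := fun v => rfl
  obtain ⟨A, hA, hlim⟩ := exists_countable_tendsto_step β (C := |C|) (by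
    intro v
    rw [hβa]
    refine (hC0 _).trans (mul_le_mul_of_nonneg_left ?_ (abs_nonneg C))
    refine (Finset.prod_le_prod (fun _ _ => norm_nonneg _)
      fun j _ => norm_tensorFun_le _).trans_eq ?_
    rw [← e.prod_comp fun p => ‖v p‖, Fintype.prod_sigma])
  refine ⟨A, hA, fun a j i hji => ?_⟩
  set a' : Fin (∑ _ : Fin ℓ, m) → I := fun p => a (e.symm p).1 (e.symm p).2 with ha'
  have h0 : ∀ j i, a' (e ⟨j, i⟩) = a j i := fun j i => by simp [ha']
  have h1 := hlim a' (e ⟨j, i⟩) (by rwa [h0])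
  rw [h0] at h1
  have h2 : (β fun p => step (a' p)) = α fun j' => orthant (a j') := by
    simp only [hβa, h0, tensorFun_step]
  have h3 : ∀ y, (β fun p => step (Function.update a' (e ⟨j, i⟩) y p))
      = α fun j' => orthant (Function.update a j (Function.update (a j) i y) j') := by
    intro y
    rw [hβa]
    simp only [tensorFun_step]
    congr 1
    ext j' : 1
    congr 1
    ext i' : 1
    by_cases hj : j' = j
    · subst hj
      by_cases hi : i' = i
      · subst hi
        simp
      · have hne : e ⟨j', i'⟩ ≠ e ⟨j', i⟩ := fun h => hi (by simpa using e.injective h)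
        rw [Function.update_of_ne hne, h0, Function.update_self, Function.update_of_ne hi]
    · have hne : e ⟨j', i'⟩ ≠ e ⟨j, i⟩ := fun h => hj (congrArg Sigma.fst (e.injective h))
      rw [Function.update_of_ne hne, h0, Function.update_of_ne hj]
  simp only [h2, h3] at h1
  exact h1

/-- Convergence to `0` of uniformly bounded multilinear forms extends from a set `G` to the closure
of its span. -/
theorem tendsto_zero_of_mem_closure_span {ι κ V : Type*} [Fintype ι] [NormedAddCommGroup V]
    [NormedSpace ℝ V] {l : Filter κ} (Δ : κ → MultilinearMap ℝ (fun _ : ι => V) ℝ) {C : ℝ}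
    (hC : ∀ k v, |Δ k v| ≤ C * ∏ i, ‖v i‖) {G : Set V}
    (hG : ∀ v, (∀ i, v i ∈ G) → Tendsto (fun k => Δ k v) l (𝓝 0)) (v : ι → V)
    (hv : ∀ i, v i ∈ closure (Submodule.span ℝ G : Set V)) :
    Tendsto (fun k => Δ k v) l (𝓝 0) := by
  classical
  have key : ∀ (s : Finset ι) (v : ι → V), (∀ i ∈ s, v i ∈ closure (Submodule.span ℝ G : Set V)) →
      (∀ i ∉ s, v i ∈ G) → Tendsto (fun k => Δ k v) l (𝓝 0) := by
    intro s
    induction s using Finset.induction_on with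
    | empty => exact fun v _ h => hG v fun i => h i (by simp)
    | insert i s hi ih =>
      intro v hv1 hv2
      have hspan : ∀ x ∈ Submodule.span ℝ G,
          Tendsto (fun k => Δ k (Function.update v i x)) l (𝓝 0) := by
        intro x hx
        induction hx using Submodule.span_induction with
        | mem x hx =>
          refine ih _ (fun k hk => ?_) fun k hk => ?_
          · rw [Function.update_of_ne (ne_of_mem_of_not_mem hk hi)]
            exact hv1 k (Finset.mem_insert_of_mem hk)
          · by_cases hki : k = i
            · subst hki; simpa using hx
            · rw [Function.update_of_ne hki]
              exact hv2 k (by simp [hki, hk])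
        | zero => simpa [MultilinearMap.map_update_zero] using tendsto_const_nhds
        | add x y _ _ hx hy => simpa using hx.add hy
        | smul c x _ hx => simpa using hx.const_mul c
      set K := |C| * ∏ k ∈ Finset.univ.erase i, ‖v k‖ with hK
      have hK0 : 0 ≤ K := by positivity
      have hbound : ∀ k x, |Δ k (Function.update v i x)| ≤ K * ‖x‖ := by
        intro k x
        refine (hC k _).trans ?_
        rw [← Finset.mul_prod_erase _ _ (Finset.mem_univ i), Function.update_self,
          Finset.prod_congr rfl fun k hk => by
            rw [Function.update_of_ne (Finset.ne_of_mem_erase hk)]]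
        have h1 : 0 ≤ ‖x‖ * ∏ k ∈ Finset.univ.erase i, ‖v k‖ := by positivity
        calc C * (‖x‖ * ∏ k ∈ Finset.univ.erase i, ‖v k‖)
            ≤ |C| * (‖x‖ * ∏ k ∈ Finset.univ.erase i, ‖v k‖) :=
              mul_le_mul_of_nonneg_right (le_abs_self C) h1
          _ = K * ‖x‖ := by rw [hK]; ring
      rw [Metric.tendsto_nhds]
      intro ε hε
      obtain ⟨x, hx, hvx⟩ := Metric.mem_closure_iff.1 (hv1 i (Finset.mem_insert_self i s))
        (ε / 2 / (K + 1)) (by positivity)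
      filter_upwards [Metric.tendsto_nhds.1 (hspan x hx) (ε / 2) (half_pos hε)] with k hk
      rw [dist_eq_norm, sub_zero, Real.norm_eq_abs] at hk ⊢
      rw [dist_eq_norm, lt_div_iff₀ (by positivity)] at hvx
      have h1 : Δ k v = Δ k (Function.update v i x) + Δ k (Function.update v i (v i - x)) := by
        rw [← MultilinearMap.map_update_add, add_sub_cancel, Function.update_eq_self]
      have h2 := hbound k (v i - x)
      rw [h1]
      refine (abs_add_le _ _).trans_lt ?_
      nlinarith [norm_nonneg (v i - x)]
  exact key Finset.univ v (fun i _ => hv i) fun i hi => absurd (Finset.mem_univ i) hi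

/-! ### Measurability -/

theorem mem_closure_span_range_orthant (f : CadlagSpace m) :
    f ∈ closure (Submodule.span ℝ (Set.range (orthant (m := m))) : Set (CadlagSpace m)) := by
  have := f.mem_closure_span_orthant (Z := ∅) (by simp) (by simp) (by simp) (by simp)
  simpa using this

/-- The operator that rounds the coordinate `i` down to `Q`. -/
noncomputable def floorCoord (i : Fin m) (Q : Finset I) : CadlagSpace m →ₗ[ℝ] CadlagSpace m :=
  compCoord (Function.update (fun _ => id) i (floorTo Q)) fun k => by
    by_cases hk : k = i
    · subst hk; simpa using isCadlagMap_floorTo Q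
    · simpa [hk] using isCadlagMap_id

theorem floorCoord_apply (i : Fin m) (Q : Finset I) (f : CadlagSpace m) (s : Fin m → I) :
    floorCoord i Q f s = f (Function.update s i (floorTo Q (s i))) := by
  rw [floorCoord, compCoord_apply]
  congr 1
  ext k : 1
  by_cases hk : k = i
  · subst hk; simp
  · simp [hk]

theorem floorCoord_orthant (i : Fin m) {Q : Finset I} (h0 : 0 ∈ Q) (h1 : 1 ∈ Q) (a : Fin m → I) :
    floorCoord i Q (orthant a) = orthant (Function.update a i (ceilTo Q (a i))) := by
  rw [floorCoord, compCoord_orthant (c := Function.update (fun _ => id) i (ceilTo Q))]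
  · congr 1
    ext k : 1
    by_cases hk : k = i
    · subst hk; simp
    · simp [hk]
  · intro k x y
    by_cases hk : k = i
    · subst hk; simpa using ceilTo_le_iff h0 h1 x y
    · simp [hk]

/-- A bounded multilinear form on `D([0,1]^m)` has a sequence of finite sets `Q n` such that its
value is the limit of the values after rounding any one coordinate of any one argument down to
`Q n`. -/
theorem exists_seq_tendsto_floorCoord {ℓ : ℕ}
    (α : MultilinearMap ℝ (fun _ : Fin ℓ => CadlagSpace m) ℝ) {C : ℝ}
    (hC : ∀ v, |α v| ≤ C * ∏ j, ‖v j‖) :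
    ∃ Q : ℕ → Finset I, (∀ n, 0 ∈ Q n) ∧ ∀ (j : Fin ℓ) (i : Fin m) (g : Fin ℓ → CadlagSpace m),
      Tendsto (fun n => α (Function.update g j (floorCoord i (Q n) (g j)))) atTop (𝓝 (α g)) := by
  classical
  obtain ⟨A₀, hA₀, hlim⟩ := exists_countable_tendsto_orthant α hC
  obtain ⟨D, hDc, hD⟩ := TopologicalSpace.exists_countable_dense I
  set A : Set I := insert 1 (A₀ ∪ D)
  obtain ⟨e, he⟩ := ((hA₀.union hDc).insert 1).exists_eq_range (Set.insert_nonempty _ _)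
  set Q : ℕ → Finset I := fun n => insert 0 (insert 1 ((Finset.range n).image e)) with hQ
  have hQ0 : ∀ n, 0 ∈ Q n := fun n => by simp [hQ]
  have hQ1 : ∀ n, 1 ∈ Q n := fun n => by simp [hQ]
  have hQA : ∀ x ∈ insert (0 : I) A, ∀ᶠ n in atTop, x ∈ Q n := by
    rintro x (rfl | hx)
    · exact Eventually.of_forall hQ0
    · change x ∈ insert 1 (A₀ ∪ D) at hx
      rw [he] at hx
      obtain ⟨k, rfl⟩ := hx
      filter_upwards [eventually_gt_atTop k] with n hn
      simp only [hQ, Finset.mem_insert, Finset.mem_image, Finset.mem_range]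
      exact Or.inr (Or.inr ⟨k, hn, rfl⟩)
  have hAQ : ∀ n, ∀ x ∈ Q n, x ∈ insert (0 : I) A := by
    intro n x hx
    simp only [hQ, Finset.mem_insert, Finset.mem_image] at hx
    rcases hx with rfl | rfl | ⟨k, -, rfl⟩
    · exact Set.mem_insert _ _
    · exact Set.mem_insert_of_mem _ (Set.mem_insert _ _)
    · refine Set.mem_insert_of_mem _ ?_
      change e k ∈ insert 1 (A₀ ∪ D)
      rw [he]
      exact ⟨k, rfl⟩
  -- Rounding `orthant a` down amounts to rounding the vertex up: the vertex does not move from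
  -- some `n` on if it is in `A`, and otherwise it converges strictly from the right.
  have hceil : ∀ (a : Fin ℓ → Fin m → I) (j : Fin ℓ) (i : Fin m),
      Tendsto (fun n => α fun j' =>
        orthant (Function.update a j (Function.update (a j) i (ceilTo (Q n) (a j i))) j'))
        atTop (𝓝 (α fun j' => orthant (a j'))) := by
    intro a j i
    by_cases ha : a j i ∈ insert (0 : I) A
    · refine tendsto_const_nhds.congr' ?_
      filter_upwards [hQA _ ha] with n hn
      rw [le_antisymm (ceilTo_le hn le_rfl) (le_ceilTo (Q n) (a j i)), Function.update_eq_self,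
        Function.update_eq_self]
    · have hA₀' : a j i ∉ A₀ := fun h =>
        ha (Set.mem_insert_of_mem _ (Set.mem_insert_of_mem _ (Or.inl h)))
      refine (hlim a j i hA₀').comp
        (tendsto_nhdsWithin_iff.2 ⟨?_, Eventually.of_forall fun n => ?_⟩)
      · refine tendsto_order.2 ⟨fun b hb => Eventually.of_forall fun n =>
          hb.trans_le (le_ceilTo _ _), fun b hb => ?_⟩
        obtain ⟨d, hdD, hd⟩ := hD.exists_mem_open isOpen_Ioo (Set.nonempty_Ioo.2 hb)
        filter_upwards [hQA d (Set.mem_insert_of_mem _ (Set.mem_insert_of_mem _ (Or.inr hdD)))]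
          with n hn
        exact (ceilTo_le hn hd.1.le).trans_lt hd.2
      · refine lt_of_le_of_ne (le_ceilTo _ _) fun h => ha ?_
        rw [h]
        exact hAQ n _ (ceilTo_mem (hQ1 n) _)
  refine ⟨Q, hQ0, fun j i g => ?_⟩
  set R : ℕ → Fin ℓ → CadlagSpace m →ₗ[ℝ] CadlagSpace m := fun n j' =>
    if j' = j then floorCoord i (Q n) else LinearMap.id with hR
  have hRupd : ∀ n (v : Fin ℓ → CadlagSpace m),
      (fun j' => R n j' (v j')) = Function.update v j (floorCoord i (Q n) (v j)) := by
    intro n v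
    ext j' : 1
    by_cases hj : j' = j
    · subst hj; simp [hR]
    · simp [hR, hj]
  have hRn : ∀ n j' f, ‖R n j' f‖ ≤ ‖f‖ := by
    intro n j' f
    simp only [hR]
    split_ifs
    · exact norm_compCoord_le _ _ f
    · exact le_rfl
  have hC0 : ∀ v, |α v| ≤ |C| * ∏ j, ‖v j‖ := fun v => (hC v).trans
    (mul_le_mul_of_nonneg_right (le_abs_self C) (Finset.prod_nonneg fun _ _ => norm_nonneg _))
  have hΔ := tendsto_zero_of_mem_closure_span (l := atTop) (C := |C| + |C|)
    (fun n => α.compLinearMap (R n) - α) (by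
      intro n v
      rw [_root_.sub_apply, MultilinearMap.compLinearMap_apply, add_mul]
      refine (abs_sub _ _).trans (add_le_add ((hC0 _).trans ?_) (hC0 _))
      exact mul_le_mul_of_nonneg_left (Finset.prod_le_prod (fun _ _ => norm_nonneg _)
        fun j' _ => hRn n j' _) (abs_nonneg C))
    (G := Set.range orthant) (by
      intro v hv
      choose a ha using hv
      obtain rfl : (fun j' => orthant (a j')) = v := funext ha
      have h1 := (hceil a j i).sub_const (α fun j' => orthant (a j'))
      rw [sub_self] at h1
      refine h1.congr fun n => ?_
      rw [_root_.sub_apply, MultilinearMap.compLinearMap_apply,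
        hRupd n fun j' => orthant (a j'), floorCoord_orthant i (hQ0 n) (hQ1 n)]
      congr 2
      ext j' : 1
      by_cases hj : j' = j
      · subst hj; simp
      · simp [hj]) g fun j' => mem_closure_span_range_orthant (g j')
  have h2 := hΔ.add_const (α g)
  rw [zero_add] at h2
  refine h2.congr fun n => ?_
  rw [_root_.sub_apply, MultilinearMap.compLinearMap_apply, hRupd, sub_add_cancel]

/-- The function `f ↦ α (f, …, f)` is measurable for the `σ`-field of the point evaluations, for
every bounded multilinear form `α`: it is an iterated limit, one coordinate of one argument at a
time, of functions of finitely many values of `f`. -/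
theorem measurable_multilinear_diag {Ω : Type*} [MeasurableSpace Ω] {ℓ : ℕ}
    (α : MultilinearMap ℝ (fun _ : Fin ℓ => CadlagSpace m) ℝ) {C : ℝ}
    (hC : ∀ v, |α v| ≤ C * ∏ j, ‖v j‖) {X : Ω → CadlagSpace m}
    (hX : ∀ t, Measurable fun ω => X ω t) : Measurable fun ω => α fun _ => X ω := by
  classical
  obtain ⟨Q, hQ0, hQ⟩ := exists_seq_tendsto_floorCoord α hC
  set r : Finset (Fin ℓ × Fin m) → (Fin ℓ × Fin m → ℕ) → Fin ℓ → Fin m → I → I := fun S n j i =>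
    if (j, i) ∈ S then id else floorTo (Q (n (j, i))) with hr
  have hrc : ∀ S n j i, IsCadlagMap (r S n j i) := by
    intro S n j i
    simp only [hr]
    split_ifs
    exacts [isCadlagMap_id, isCadlagMap_floorTo _]
  -- `S` is the set of the coordinates that are not rounded.
  have key : ∀ (S : Finset (Fin ℓ × Fin m)) (n : Fin ℓ × Fin m → ℕ),
      Measurable fun ω => α fun j => compCoord (r S n j) (hrc S n j) (X ω) := by
    intro S
    induction S using Finset.induction_on with
    | empty =>
      intro n
      choose e _ he using fun j : Fin ℓ =>
        exists_compCoord_floorTo_eq_sum (Q := fun i => Q (n (j, i))) fun i => hQ0 _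
      have h1 : ∀ j f, compCoord (r ∅ n j) (hrc ∅ n j) f
          = ∑ q ∈ Fintype.piFinset fun i => Q (n (j, i)), f q • e j q := by
        intro j f
        rw [← he]
        rfl
      simp only [h1, MultilinearMap.map_sum_finset, MultilinearMap.map_smul_univ]
      exact Finset.measurable_fun_sum _ fun q _ =>
        (Finset.measurable_fun_prod _ fun j _ => hX _).smul_const _
    | insert p S hp ih =>
      intro n
      refine measurable_of_tendsto_metrizable (fun k => ih (Function.update n p k))
        (tendsto_pi_nhds.2 fun ω => ?_)
      refine (hQ p.1 p.2 fun j => compCoord (r (insert p S) n j)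
        (hrc (insert p S) n j) (X ω)).congr fun k => ?_
      congr 1
      ext j : 1
      refine DFunLike.ext _ _ fun s => ?_
      rw [compCoord_apply]
      by_cases hj : j = p.1
      · subst hj
        rw [Function.update_self, floorCoord_apply, compCoord_apply]
        congr 1
        ext i : 1
        by_cases hi : i = p.2
        · subst hi
          simp [hr, hp]
        · have hne : (p.1, i) ≠ p := fun h => hi (congrArg Prod.snd h)
          simp [hr, hi, hne]
      · rw [Function.update_of_ne hj, compCoord_apply]
        congr 1
        ext i : 1
        have hne : (j, i) ≠ p := fun h => hj (congrArg Prod.fst h)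
        simp [hr, hne]
  have h1 := key Finset.univ 0
  have h2 : ∀ j f, compCoord (r Finset.univ 0 j) (hrc Finset.univ 0 j) f = f := by
    intro j f
    refine DFunLike.ext _ _ fun s => ?_
    simp [hr]
  simpa only [h2] using h1

end CadlagSpace

/-! ### Fixed jumps of a random function -/

namespace CadlagSpace

variable {m : ℕ} {Ω : Type*} [MeasurableSpace Ω] {P : Measure Ω}

/-- If only finitely many of the values `J x ω`, `x ∈ K`, exceed any given `ε > 0`, for every `ω`,
then `J x = 0` almost surely for all but countably many `x`. -/
theorem countable_setOf_not_ae_eq_zero [IsFiniteMeasure P] {K : Type*} (J : K → Ω → ℝ)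
    (hJm : ∀ x, Measurable (J x)) (hJ0 : ∀ x ω, 0 ≤ J x ω) (hJ1 : ∀ x ω, J x ω ≤ 1)
    (hJ : ∀ ω, ∀ ε > 0, {x | ε < J x ω}.Finite) : {x | ¬ ∀ᵐ ω ∂P, J x ω = 0}.Countable := by
  have hint : ∀ x, Integrable (J x) P := fun x =>
    Integrable.of_bound (hJm x).aestronglyMeasurable 1 (Eventually.of_forall fun ω => by
      rw [Real.norm_of_nonneg (hJ0 x ω)]
      exact hJ1 x ω)
  have hfin : ∀ n : ℕ, {x | 1 / ((n : ℝ) + 1) < ∫ ω, J x ω ∂P}.Finite := by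
    intro n
    by_contra hinf
    have hinf : {x | 1 / ((n : ℝ) + 1) < ∫ ω, J x ω ∂P}.Infinite := hinf
    set e := hinf.natEmbedding
    have hlim : ∀ ω, Tendsto (fun k => J (e k) ω) atTop (𝓝 0) := by
      intro ω
      rw [Metric.tendsto_nhds]
      intro ε hε
      have h1 : {k : ℕ | ε / 2 < J (e k) ω}.Finite :=
        Set.Finite.preimage (f := fun k => (e k : K))
          (fun a _ b _ h => e.injective (Subtype.ext h)) (hJ ω (ε / 2) (half_pos hε))
      have h2 := h1.compl_mem_cofinite
      rw [Nat.cofinite_eq_atTop] at h2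
      filter_upwards [h2] with k hk
      rw [dist_eq_norm, sub_zero, Real.norm_of_nonneg (hJ0 _ ω)]
      exact (not_lt.1 (show ¬ ε / 2 < J (e k) ω from hk)).trans_lt (half_lt_self hε)
    have h1 := tendsto_integral_of_dominated_convergence (μ := P) (F := fun k => J (e k))
      (f := fun _ => (0 : ℝ)) (fun _ => 1) (fun k => (hJm _).aestronglyMeasurable)
      (integrable_const 1) (fun k => Eventually.of_forall fun ω => by
        rw [Real.norm_of_nonneg (hJ0 _ ω)]
        exact hJ1 _ ω) (Eventually.of_forall hlim)
    rw [integral_zero] at h1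
    have h2 := ge_of_tendsto' h1 fun k => (e k).2.le
    exact absurd h2 (not_le.2 (by positivity))
  refine (Set.countable_iUnion fun n => (hfin n).countable).mono fun x hx => ?_
  have hpos : 0 < ∫ ω, J x ω ∂P := by
    refine lt_of_le_of_ne (integral_nonneg (hJ0 x)) fun h => hx ?_
    exact (integral_eq_zero_iff_of_nonneg (hJ0 x) (hint x)).1 h.symm
  obtain ⟨n, hn⟩ := exists_nat_one_div_lt hpos
  exact Set.mem_iUnion.2 ⟨n, hn⟩

/-- The left limit of `f` along a line in a coordinate direction. -/
theorem exists_tendsto_update_left (f : CadlagSpace m) (s : Fin m → I) (i : Fin m) (x : I) :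
    ∃ L : ℝ, Tendsto (fun y => f (Function.update s i y)) (𝓝[<] x) (𝓝 L) := by
  obtain ⟨L, hL⟩ := f.isCadlag (Function.update s i x) {i}
  refine ⟨L, hL.comp ?_⟩
  rw [nhdsWithin_octant, tendsto_pi]
  intro k
  by_cases hk : k = i
  · subst hk
    have : halfLine (k ∈ ({k} : Set (Fin m))) (Function.update s k x k) = Set.Iio x := by
      ext y
      simp [halfLine]
    rw [this, Function.update_self]
    simp only [Function.update_self]
    exact tendsto_id
  · simp only [Function.update_of_ne hk]
    refine tendsto_nhdsWithin_iff.2 ⟨tendsto_const_nhds, Eventually.of_forall fun y => ?_⟩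
    simp [halfLine, hk]

/-- Along a line in a coordinate direction, `f` has finitely many jumps larger than a given
`ε`. -/
theorem finite_setOf_lt_abs_sub_left (f : CadlagSpace m) (s : Fin m → I) (i : Fin m)
    {L : Set.Ioi (0 : I) → ℝ}
    (hL : ∀ x : Set.Ioi (0 : I), Tendsto (fun y => f (Function.update s i y)) (𝓝[<] (x : I))
      (𝓝 (L x))) {ε : ℝ} (hε : 0 < ε) :
    {x : Set.Ioi (0 : I) | ε < |f (Function.update s i x) - L x|}.Finite := by
  obtain ⟨Q, -, -, -, hQ⟩ := f.isCadlag.exists_floorTo_approx (Z := ∅) (by simp) (by simp)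
    (by simp) (by simp) (half_pos hε)
  refine Set.Finite.subset (Set.Finite.preimage Subtype.val_injective.injOn Q.finite_toSet)
    fun x hx => ?_
  by_contra hxQ
  have hne : (𝓝[<] (x : I)).NeBot := nhdsLT_neBot_of_exists_lt ⟨0, x.2⟩
  have hfloor : ∀ᶠ y in 𝓝[<] (x : I), floorTo Q y = floorTo Q x := by
    have h1 : ∀ᶠ y in 𝓝[<] (x : I), ∀ q ∈ Q, (q ≤ y ↔ q ≤ x) := by
      rw [Finset.eventually_all]
      intro q hq
      rcases lt_trichotomy q x with h | h | h
      · filter_upwards [nhdsWithin_le_nhds (lt_mem_nhds h)] with y hy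
        exact ⟨fun _ => h.le, fun _ => hy.le⟩
      · exact absurd (show x.1 ∈ Q from h ▸ hq) hxQ
      · filter_upwards [self_mem_nhdsWithin] with y hy
        exact ⟨fun h' => absurd (h.trans_le h') (not_lt.2 (le_of_lt hy)),
          fun h' => absurd h (not_lt.2 h')⟩
    filter_upwards [h1] with y hy
    rw [floorTo, floorTo, Finset.filter_congr hy]
  have h2 : |f (Function.update s i x) - L x| ≤ ε := by
    refine le_of_tendsto ((hL x).const_sub _).abs ?_
    filter_upwards [hfloor] with y hy
    have h3 := hQ (Function.update s i x)
    have h4 := hQ (Function.update s i y)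
    have h5 : (fun k => floorTo Q (Function.update s i y k))
        = fun k => floorTo Q (Function.update s i (x : I) k) := by
      ext k : 1
      by_cases hk : k = i
      · subst hk; simpa using hy
      · simp [hk]
    rw [h5] at h4
    rw [abs_le] at *
    constructor <;> linarith
  exact absurd hx (not_lt.2 h2)

/-- Outside countably many hyperplanes, a random element of `D([0,1]^m)` almost surely does not
jump across a given coordinate hyperplane. -/
theorem exists_countable_ae_noJump [IsFiniteMeasure P] {X : Ω → CadlagSpace m}
    (hX : ∀ t, Measurable fun ω => X ω t) :
    ∃ F : Set I, F.Countable ∧ ∀ i, ∀ x ∉ F, 0 < x → ∀ᵐ ω ∂P, NoJump (X ω) i x := by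
  obtain ⟨D, hDc, hD⟩ := TopologicalSpace.exists_countable_dense I
  set C := insert 1 D
  have hC : Dense C := hD.mono (Set.subset_insert _ _)
  have hCpi : {s : Fin m → I | ∀ k, s k ∈ C}.Countable := by
    have := Set.countable_univ_pi (s := fun _ : Fin m => C) fun _ => hDc.insert 1
    simpa [Set.pi] using this
  have key : ∀ (s : Fin m → I) (i : Fin m), ∃ F : Set I, F.Countable ∧ ∀ x ∉ F, 0 < x →
      ∀ᵐ ω ∂P, Tendsto (fun y => X ω (Function.update s i y)) (𝓝[<] x)
        (𝓝 (X ω (Function.update s i x))) := by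
    intro s i
    choose L hL using fun (x : Set.Ioi (0 : I)) ω =>
      (X ω).exists_tendsto_update_left s i (x : I)
    have hLm : ∀ x, Measurable (L x) := by
      intro x
      obtain ⟨u, -, hu1, hu2⟩ := exists_seq_strictMono_tendsto' (show (0 : I) < x from x.2)
      have hu3 : Tendsto u atTop (𝓝[<] (x : I)) :=
        tendsto_nhdsWithin_iff.2 ⟨hu2, Eventually.of_forall fun n => (hu1 n).2⟩
      exact measurable_of_tendsto_metrizable (fun n => hX (Function.update s i (u n)))
        (tendsto_pi_nhds.2 fun ω => (hL x ω).comp hu3)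
    have h1 := countable_setOf_not_ae_eq_zero (P := P)
      (fun (x : Set.Ioi (0 : I)) ω => min 1 |X ω (Function.update s i x) - L x ω|)
      (fun x => measurable_const.min (((hX _).sub (hLm x)).abs))
      (fun x ω => le_min zero_le_one (abs_nonneg _)) (fun x ω => min_le_left _ _)
      (fun ω ε hε => ((X ω).finite_setOf_lt_abs_sub_left s i (fun x => hL x ω) hε).subset
        fun x hx => lt_of_lt_of_le (show ε < min 1 _ from hx) (min_le_right _ _))
    refine ⟨_, h1.image Subtype.val, fun x hx hx0 => ?_⟩
    have h2 : ∀ᵐ ω ∂P, min 1 |X ω (Function.update s i x) - L ⟨x, hx0⟩ ω| = 0 := by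
      by_contra h
      exact hx ⟨⟨x, hx0⟩, h, rfl⟩
    filter_upwards [h2] with ω hω
    have h3 : X ω (Function.update s i x) = L ⟨x, hx0⟩ ω := by
      rcases min_choice 1 |X ω (Function.update s i x) - L ⟨x, hx0⟩ ω| with h | h
      · rw [h] at hω
        exact absurd hω one_ne_zero
      · rw [h] at hω
        exact sub_eq_zero.1 (abs_eq_zero.1 hω)
    rw [h3]
    exact hL ⟨x, hx0⟩ ω
  choose F hF hFX using key
  refine ⟨⋃ s ∈ {s : Fin m → I | ∀ k, s k ∈ C}, ⋃ i, F s i,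
    hCpi.biUnion fun s _ => Set.countable_iUnion fun i => hF s i, fun i x hx hx0 => ?_⟩
  have h1 : ∀ᵐ ω ∂P, ∀ s ∈ {s : Fin m → I | ∀ k, s k ∈ C},
      Tendsto (fun y => X ω (Function.update s i y)) (𝓝[<] x)
        (𝓝 (X ω (Function.update s i x))) := by
    rw [ae_ball_iff hCpi]
    intro s hs
    refine hFX s i x (fun h => hx ?_) hx0
    exact Set.mem_biUnion hs (Set.mem_iUnion.2 ⟨i, h⟩)
  filter_upwards [h1] with ω hω
  exact noJump_of_tendsto hC (Set.mem_insert _ _) hω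

/-- The supremum norm is measurable for the point evaluations, since it is a supremum over a
countable set of points. -/
theorem measurable_norm_of_eval {X : Ω → CadlagSpace m} (hX : ∀ t, Measurable fun ω => X ω t) :
    Measurable fun ω => ‖X ω‖ := by
  obtain ⟨D, hDc, hD⟩ := TopologicalSpace.exists_countable_dense I
  set C := insert 1 D
  have hC : Dense C := hD.mono (Set.subset_insert _ _)
  have hCpi : {s : Fin m → I | ∀ k, s k ∈ C}.Countable := by
    have := Set.countable_univ_pi (s := fun _ : Fin m => C) fun _ => hDc.insert 1
    simpa [Set.pi] using this
  refine measurable_of_Iic fun c => ?_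
  have h1 : (fun ω => ‖X ω‖) ⁻¹' Set.Iic c
      = ⋂ s ∈ {s : Fin m → I | ∀ k, s k ∈ C}, (fun ω => |X ω s|) ⁻¹' Set.Iic c := by
    ext ω
    simp only [Set.mem_preimage, Set.mem_Iic, Set.mem_iInter]
    refine ⟨fun h s _ => (abs_apply_le_norm _ s).trans h, fun h => norm_le_of_forall fun t => ?_⟩
    obtain ⟨L, hL⟩ := (X ω).isCadlag t ∅
    rw [nhdsWithin_octant] at hL
    have hpure : pure t ≤ Filter.pi fun i => 𝓝[halfLine (i ∈ (∅ : Set (Fin m))) (t i)] t i := by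
      rw [← nhdsWithin_octant]
      exact pure_le_nhdsWithin fun i => ⟨fun h => h.elim, fun _ => le_rfl⟩
    have hLt : X ω t = L := tendsto_nhds_unique (tendsto_pure_nhds _ t) (hL.mono_left hpure)
    rw [hLt]
    by_contra! hcon
    obtain ⟨J, -, V, hV, hVs⟩ := Filter.mem_pi.1 (hL.abs.eventually (lt_mem_nhds hcon))
    choose s hsV hsC using fun i => exists_mem_of_mem_nhdsWithin_halfLine hC
      (Set.mem_insert _ _) (fun h => h.elim) (hV i)
    exact absurd (h s hsC) (not_le.2 (hVs (a := s) fun i _ => hsV i))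
  rw [h1]
  exact MeasurableSet.biInter hCpi fun s _ => (hX s).abs measurableSet_Iic

/-! ### Moments -/

theorem measurable_eval_of_measurable {X : Ω → CadlagSpace m} (hX : Measurable X)
    (t : Fin m → I) : Measurable fun ω => X ω t := by
  have h1 : Measurable fun f : CadlagSpace m => f t := by
    refine Measurable.of_comap_le ?_
    exact le_iSup (fun t : Fin m → I =>
      MeasurableSpace.comap (fun f : CadlagSpace m => f t) inferInstance) t
  exact h1.comp hX

/-- Let `A₀` be a countable dense set that contains `0`, `1` and the fixed jumps of `X`. A bounded
multilinear form `α` that vanishes on the orthant indicators with vertices in `A₀` satisfies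
`α (X, …, X) = 0` almost surely. -/
theorem ae_multilinear_diag_eq_zero {ℓ : ℕ}
    (α : MultilinearMap ℝ (fun _ : Fin ℓ => CadlagSpace m) ℝ) {C : ℝ}
    (hC : ∀ v, |α v| ≤ C * ∏ j, ‖v j‖) {X : Ω → CadlagSpace m} {A₀ : Set I} (hA₀ : Dense A₀)
    (h0 : 0 ∈ A₀) (h1 : 1 ∈ A₀) (hX : ∀ i, ∀ x ∉ A₀, ∀ᵐ ω ∂P, NoJump (X ω) i x)
    (hα : ∀ a : Fin ℓ → Fin m → I, (∀ j i, a j i ∈ A₀) → α (fun j => orthant (a j)) = 0) :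
    ∀ᵐ ω ∂P, α (fun _ => X ω) = 0 := by
  classical
  obtain ⟨A, hA, hlim⟩ := exists_countable_tendsto_orthant α hC
  set Z := A \ A₀
  have hZ : Dense Zᶜ := hA₀.mono fun x hx h => h.2 hx
  -- A coordinate outside `Z` is in `A₀` or a point of continuity, hence reached from `A₀`.
  have hvanish : ∀ (S : Finset (Fin ℓ × Fin m)) (a : Fin ℓ → Fin m → I),
      (∀ j i, (j, i) ∉ S → a j i ∈ A₀) → (∀ j i, a j i ∉ Z) →
      α (fun j => orthant (a j)) = 0 := by
    intro S
    induction S using Finset.induction_on with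
    | empty => exact fun a ha _ => hα a fun j i => ha j i (by simp)
    | insert p S hp ih =>
      intro a ha haZ
      by_cases hpA₀ : a p.1 p.2 ∈ A₀
      · refine ih a (fun j i hji => ?_) haZ
        by_cases h : (j, i) = p
        · subst h; exact hpA₀
        · exact ha j i (by simp [h, hji])
      · have hpA : a p.1 p.2 ∉ A := fun h => haZ p.1 p.2 ⟨h, hpA₀⟩
        have hp1 : a p.1 p.2 < 1 := lt_of_le_of_ne unitInterval.le_one' fun h => hpA₀ (h ▸ h1)
        have hne : (𝓝[>] (a p.1 p.2)).NeBot := nhdsGT_neBot_of_exists_gt ⟨1, hp1⟩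
        refine tendsto_nhds_unique_of_frequently_eq (hlim a p.1 p.2 hpA) tendsto_const_nhds
          (frequently_iff.2 fun {U} hU => ?_)
        obtain ⟨u, hu, huU⟩ := (mem_nhdsGT_iff_exists_Ioo_subset' hp1).1 hU
        obtain ⟨y, hyA₀, hy⟩ := hA₀.exists_mem_open isOpen_Ioo (Set.nonempty_Ioo.2 hu)
        refine ⟨y, huU hy, ih _ (fun j i hji => ?_) fun j i => ?_⟩
        · by_cases hj : j = p.1
          · subst hj
            rw [Function.update_self]
            by_cases hi : i = p.2
            · subst hi; simpa using hyA₀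
            · rw [Function.update_of_ne hi]
              exact ha _ _ fun h => (Finset.mem_insert.1 h).elim
                (fun h => hi (congrArg Prod.snd h)) hji
          · rw [Function.update_of_ne hj]
            exact ha _ _ fun h => (Finset.mem_insert.1 h).elim
              (fun h => hj (congrArg Prod.fst h)) hji
        · by_cases hj : j = p.1
          · subst hj
            rw [Function.update_self]
            by_cases hi : i = p.2
            · subst hi
              rw [Function.update_self]
              exact fun h => h.2 hyA₀
            · rw [Function.update_of_ne hi]
              exact haZ _ _
          · rw [Function.update_of_ne hj]
            exact haZ _ _
  have hae : ∀ᵐ ω ∂P, ∀ x ∈ Z, ∀ i, NoJump (X ω) i x := by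
    rw [ae_ball_iff (hA.mono Set.sdiff_subset)]
    exact fun x hx => ae_all_iff.2 fun i => hX i x hx.2
  filter_upwards [hae] with ω hω
  have h2 := tendsto_zero_of_mem_closure_span (l := (⊤ : Filter Unit)) (fun _ => α)
    (fun _ v => hC v) (G := orthant '' {a : Fin m → I | ∀ i, a i ∉ Z}) (by
      intro v hv
      choose a ha hav using hv
      obtain rfl : (fun j => orthant (a j)) = v := funext hav
      rw [hvanish Finset.univ a (fun j i h => absurd (Finset.mem_univ _) h) ha]
      exact tendsto_const_nhds) (fun _ => X ω)
    fun _ => (X ω).mem_closure_span_orthant hZ (fun h => h.2 h0) (fun h => h.2 h1)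
      fun i x hx => hω x hx i
  exact tendsto_nhds_unique tendsto_const_nhds h2

end CadlagSpace

section TensorMoments

variable {ℓ : ℕ} {B : Type*} [NormedAddCommGroup B] [NormedSpace ℝ B]

/-- The multilinear form on `B` that a functional on the projective tensor power induces. -/
noncomputable def dualToMultilinear (χ : StrongDual ℝ (ProjectiveTensorPower ℓ B)) :
    MultilinearMap ℝ (fun _ : Fin ℓ => B) ℝ :=
  ((χ : ProjectiveTensorPower ℓ B →ₗ[ℝ] ℝ) ∘ₗ
    (UniformSpace.Completion.toComplL (𝕜 := ℝ) (E := ⨂[ℝ] _ : Fin ℓ, B) :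
      (⨂[ℝ] _ : Fin ℓ, B) →ₗ[ℝ] ProjectiveTensorPower ℓ B)).compMultilinearMap
    (PiTensorProduct.tprod ℝ)

theorem dualToMultilinear_apply (χ : StrongDual ℝ (ProjectiveTensorPower ℓ B)) (v : Fin ℓ → B) :
    dualToMultilinear χ v
      = χ ((PiTensorProduct.tprod ℝ v : ⨂[ℝ] _ : Fin ℓ, B) : ProjectiveTensorPower ℓ B) := rfl

theorem abs_dualToMultilinear_le (χ : StrongDual ℝ (ProjectiveTensorPower ℓ B)) (v : Fin ℓ → B) :
    |dualToMultilinear χ v| ≤ ‖χ‖ * ∏ j, ‖v j‖ := by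
  rw [dualToMultilinear_apply]
  refine (χ.le_opNorm _).trans (mul_le_mul_of_nonneg_left ?_ (norm_nonneg _))
  rw [UniformSpace.Completion.norm_coe]
  exact PiTensorProduct.projectiveSeminorm_tprod_le v

variable (ℓ B) in
/-- The identity of the algebraic tensor power, as a contraction from the projective to the
injective norm. -/
noncomputable def projectiveToInjective :
    (⨂[ℝ] _ : Fin ℓ, B) →L[ℝ] InjectiveAlgTensor ℓ B :=
  (InjectiveAlgTensor.of ℓ B : (⨂[ℝ] _ : Fin ℓ, B) →ₗ[ℝ] InjectiveAlgTensor ℓ B).mkContinuous 1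
    fun u => by
      have : Nonempty {χ : Fin ℓ → StrongDual ℝ B // ∀ i, ‖χ i‖ ≤ 1} := ⟨⟨0, by simp⟩⟩
      rw [one_mul]
      refine ciSup_le fun ⟨χ, hχ⟩ => ?_
      set φ := (ContinuousMultilinearMap.mkPiAlgebra ℝ (Fin ℓ) ℝ).compContinuousLinearMap χ
      have h1 : ‖φ‖ ≤ 1 := by
        refine ContinuousMultilinearMap.opNorm_le_bound zero_le_one fun x => ?_
        have h2 : φ x = ∏ i, χ i (x i) := by simp [φ]
        rw [h2, norm_prod, one_mul]
        exact Finset.prod_le_prod (fun i _ => norm_nonneg _)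
          fun i _ => by simpa using (χ i).le_of_opNorm_le (hχ i) (x i)
      exact (PiTensorProduct.norm_eval_le_projectiveSeminorm φ u).trans
        (mul_le_of_le_one_left (norm_nonneg _) h1)

theorem completion_projectiveToInjective_projectivePow (x : B) :
    (projectiveToInjective ℓ B).completion (projectivePow ℓ x) = injectivePow ℓ x :=
  ContinuousLinearMap.completion_apply_coe _ _

end TensorMoments

theorem theorem8p3 {Ω : Type*} [MeasurableSpace Ω] (P : Measure Ω) [IsProbabilityMeasure P]
    (m ℓ : ℕ) (hm : 1 ≤ m) (hℓ : 1 ≤ ℓ)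
    (X : Ω → CadlagSpace m) (hX : Measurable X) (hmom : ∫⁻ ω, ‖X ω‖ₑ ^ ℓ ∂P < ⊤) :
    PettisIntegrable (fun ω => projectivePow ℓ (X ω)) P ∧
      PettisIntegrable (fun ω => injectivePow ℓ (X ω)) P := by
  have hXt := CadlagSpace.measurable_eval_of_measurable hX
  have hnorm := CadlagSpace.measurable_norm_of_eval hXt
  have hG : Integrable (fun ω => ‖X ω‖ ^ ℓ) P := by
    refine ⟨(hnorm.pow_const ℓ).aestronglyMeasurable, ?_⟩
    rw [hasFiniteIntegral_iff_enorm]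
    refine lt_of_le_of_lt (lintegral_mono fun ω => ?_) hmom
    rw [enorm_pow, enorm_norm]
  have hpow : ∀ (χ : StrongDual ℝ (ProjectiveTensorPower ℓ (CadlagSpace m))) ω,
      χ (projectivePow ℓ (X ω)) = dualToMultilinear χ fun _ => X ω := fun _ _ => rfl
  have hbound : ∀ (χ : StrongDual ℝ (ProjectiveTensorPower ℓ (CadlagSpace m))) ω,
      |χ (projectivePow ℓ (X ω))| ≤ ‖χ‖ * ‖X ω‖ ^ ℓ := by
    intro χ ω
    rw [hpow]
    simpa using abs_dualToMultilinear_le χ fun _ => X ω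
  have hmeas : ∀ χ : StrongDual ℝ (ProjectiveTensorPower ℓ (CadlagSpace m)),
      Measurable fun ω => χ (projectivePow ℓ (X ω)) := fun χ =>
    CadlagSpace.measurable_multilinear_diag _ (abs_dualToMultilinear_le χ) hXt
  have hproj : PettisIntegrable (fun ω => projectivePow ℓ (X ω)) P := by
    obtain ⟨F, hF, hFX⟩ := CadlagSpace.exists_countable_ae_noJump (P := P) hXt
    obtain ⟨D, hDc, hD⟩ := TopologicalSpace.exists_countable_dense I
    set A₀ : Set I := insert 0 (insert 1 (F ∪ D))
    have hA₀ : {a : Fin ℓ → Fin m → I | ∀ j i, a j i ∈ A₀}.Countable := by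
      have h1 := Set.countable_univ_pi (s := fun _ : Fin m => A₀)
        fun _ => ((hF.union hDc).insert 1).insert 0
      have h2 := Set.countable_univ_pi (s := fun _ : Fin ℓ => Set.univ.pi fun _ : Fin m => A₀)
        fun _ => h1
      simpa [Set.pi] using h2
    obtain ⟨a, ha⟩ := hA₀.exists_eq_range ⟨0, fun _ _ => Set.mem_insert _ _⟩
    refine pettisIntegrable_of_countable_separation
      (fun χ => ⟨hmeas χ, (hG.const_mul ‖χ‖).mono' (hmeas χ).aestronglyMeasurable
        (Eventually.of_forall (hbound χ))⟩)
      hG (fun ω => by positivity) hbound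
      (fun n => ((PiTensorProduct.tprod ℝ fun j => CadlagSpace.orthant (a n j) :
        ⨂[ℝ] _ : Fin ℓ, CadlagSpace m) : ProjectiveTensorPower ℓ (CadlagSpace m)))
      fun χ hχ => ?_
    refine CadlagSpace.ae_multilinear_diag_eq_zero (dualToMultilinear χ)
      (abs_dualToMultilinear_le χ) (A₀ := A₀) (hD.mono fun x hx => by simp [A₀, hx])
      (by simp [A₀]) (by simp [A₀]) (fun i x hx => ?_) fun b hb => ?_
    · refine hFX i x (fun h => hx (by simp [A₀, h])) ?_
      exact lt_of_le_of_ne unitInterval.nonneg' fun h => hx (by simp [A₀, ← h])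
    · obtain ⟨n, rfl⟩ : b ∈ Set.range a := ha ▸ hb
      exact hχ n
  refine ⟨hproj, ?_⟩
  have h1 := hproj.clm_comp (projectiveToInjective ℓ (CadlagSpace m)).completion
  simpa only [completion_projectiveToInjective_projectivePow] using h1
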